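/- Let $N\ge 3$, $m_1,\dots,m_N>0$, $\alpha>2$ and $\omega>0$. Let $\Delta\subset(\mathbb R^3)^N$ be the set of configurations with $x_i=x_j$ for some $i\neq j$. For $\mathbf x\in(\mathbb R^3)^N\setminus\Delta$ and $\dot{\mathbf x}\in(\mathbb R^3)^N$ put $$U(\mathbf x)=-\sum_{i<j}\frac{m_im_j}{|x_i-x_j|^{\alpha}},\quad I(\mathbf x)=\sum_i m_i|x_i|^2,\quad E(\mathbf x,\dot{\mathbf x})=\tfrac12\sum_i m_i|\dot x_i|^2+U(\mathbf x),\quad A(\mathbf x,\dot{\mathbf x})=\sum_i m_i\,x_i\times\dot x_i,$$ $$K_\omega(\mathbf x)=\omega^2I(\mathbf x)+\alpha U(\mathbf x),\qquad E^*(\omega)=\inf\Big\{\tfrac{\omega^2}{2}I(\mathbf x)+U(\mathbf x):\ \mathbf x\in(\mathbb R^3)^N\setminus\Delta,\ K_\omega(\mathbf x)=0\Big\}.$$ Let $\mathcal K=\{(\mathbf x,\dot{\mathbf x}):\mathbf x\notin\Delta,\ E(\mathbf x,\dot{\mathbf x})<E^*(\omega),\ |A(\mathbf x,\dot{\mathbf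 x})|\ne0\}$, and let $\mathcal K_1^{+},\mathcal K_1^{-},\mathcal K_2^{+},\mathcal K_2^{-}$ be the subsets of $\mathcal K$ given respectively by $$\mathcal K_1^{+}:\ |A|\ge\omega I,\ K_\omega\ge0;\qquad \mathcal K_1^{-}:\ |A|\ge\omega I,\ K_\omega<0;\qquad \mathcal K_2^{+}:\ |A|<\omega I,\ K_\omega\ge0;\qquad \mathcal K_2^{-}:\ |A|<\omega I,\ K_\omega<0.$$ Consider solutions $\mathbf x(t)$ of $m_i\ddot x_i=-\nabla_iU(\mathbf x)$ on their maximal interval $[0,\sigma)$, $0<\sigma\le\infty$. The solution exists globally if $\sigma=\infty$; it experiences a collision if $\sigma<\infty$ and $\mathbf x(t)$ converges to a point of $\Delta$ as $t\to\sigma$. A statement such as "$\mathbf x(t)$ is in $\mathcal K$" means $(\mathbf x(t),\dot{\mathbf x}(t))\in\mathcal K$, and all times are in $[0,\sigma)$. Then $\mathcal K=\mathcal K_1^{+}\cup\mathcal K_1^{-}\cup\mathcal K_2^{+}\cup\mathcal K_2^{-}$, the set $\mathcal K$ is invariant (a solution that is in $\mathcal K$ at one time is in $\mathcal K$ at all times),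 and: (a) $\mathcal K_1^+$ is empty. (b) If $\mathbf x(t)$ starts in $\mathcal K_2^-$ and is in $\mathcal K_1^-$ at some time $t_1$, then it stays in $\mathcal K_1^-$ for all $t\ge t_1$ and experiences a collision. (c) If $\mathbf x(t)$ starts in $\mathcal K_2^-$ and never enters $\mathcal K_1^-$, then it stays in $\mathcal K_2^+\cup\mathcal K_2^-$. Moreover: (c1) if there is a time $t_1$ such that $\mathbf x(t)$ is in $\mathcal K_2^-$ for all $t>t_1$, then it experiences a collision; (c2) if there is a time $t_1$ such that $\mathbf x(t)$ is in $\mathcal K_2^+$ for all $t>t_1$, then it exists globally; (c3) if there are infinitely many transitions between $\mathcal K_2^+$ and $\mathcal K_2^-$, that is, an infinite increasing sequence of times in $[0,\sigma)$ at which $\mathbf x(t)$ is alternately in $\mathcal K_2^+$ and in $\mathcal K_2^-$, then it exists globally. (d) If $\mathbf x(t)$ starts and stays in $\mathcal K_2^+$, then it exists globally. If $\mathbf x(t)$ starts and stays in $\mathcal K_1^-$, then it experiences a collision. (e) A solution leaves $\mathcal K_2^+$ or $\mathcal K_1^-$ only through $\mathcal K_2^-$: if $\mathbf x(s)$ is in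 $\mathcal K_2^+$ (resp. $\mathcal K_1^-$) and $\mathbf x(t)$ is not, for some $s<t$, then $\mathbf x(r)$ is in $\mathcal K_2^-$ for some $r\in(s,t]$. From any time $s$ at which a solution is in $\mathcal K_2^-$, the statements (b) and (c) apply with the initial time $0$ replaced by $s$. -/

import Mathlib

open scoped Topology Matrix

noncomputable section

namespace NBody

/-- Configurations (or velocities) of `N` bodies in Euclidean three-space. -/
abbrev Config (N : ℕ) : Type := Fin N → EuclideanSpace ℝ (Fin 3)

/-- The collision set: at least two of the bodies are at the same place. -/
def collisionSet (N : ℕ) : Set (Config N) :=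
  {x | ∃ i j : Fin N, i ≠ j ∧ x i = x j}

section Functionals

variable {N : ℕ}

/-- The homogeneous potential `U(x) = - ∑_{i<j} m_i m_j / |x_i - x_j|^α`. -/
def potential (m : Fin N → ℝ) (α : ℝ) (x : Config N) : ℝ :=
  -∑ i, ∑ j ∈ Finset.Ioi i, m i * m j / ‖x i - x j‖ ^ α

/-- The force on body `i`, `-∇_i U(x) = -α ∑_{j≠i} m_i m_j (x_i - x_j) / |x_i - x_j|^{α+2}`. -/
def force (m : Fin N → ℝ) (α : ℝ) (x : Config N) (i : Fin N) : EuclideanSpace ℝ (Fin 3) :=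
  -∑ j ∈ Finset.univ.erase i, (α * (m i * m j) / ‖x i - x j‖ ^ (α + 2)) • (x i - x j)

/-- The total energy `E(x, v)`. -/
def energy (m : Fin N → ℝ) (α : ℝ) (x v : Config N) : ℝ :=
  1 / 2 * ∑ i, m i * ‖v i‖ ^ 2 + potential m α x

/-- The cross product of Euclidean three-space. -/
def cross (a b : EuclideanSpace ℝ (Fin 3)) : EuclideanSpace ℝ (Fin 3) :=
  WithLp.toLp 2 (a.ofLp ⨯₃ b.ofLp)

/-- The angular momentum `A(x, v) = ∑ m_i x_i × v_i`; its norm `‖A‖` is the Euclidean one. -/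
def angularMomentum (m : Fin N → ℝ) (x v : Config N) : EuclideanSpace ℝ (Fin 3) :=
  ∑ i, m i • cross (x i) (v i)

/-- The moment of inertia `I(x) = ∑ m_i |x_i|^2`. -/
def inertia (m : Fin N → ℝ) (x : Config N) : ℝ :=
  ∑ i, m i * ‖x i‖ ^ 2

/-- The threshold function `K_ω(x) = ω² I(x) + α U(x)`. -/
def threshold (m : Fin N → ℝ) (α ω : ℝ) (x : Config N) : ℝ :=
  ω ^ 2 * inertia m x + α * potential m α x

/-- `E_ω(x) = (ω²/2) I(x) + U(x)`. -/
def rotatingEnergy (m : Fin N → ℝ) (α ω : ℝ) (x : Config N) : ℝ :=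
  ω ^ 2 / 2 * inertia m x + potential m α x

/-- The excited energy `E*(ω) = inf {E_ω(x) : x collision-free, K_ω(x) = 0}`. -/
def excitedEnergy (m : Fin N → ℝ) (α ω : ℝ) : ℝ :=
  sInf (rotatingEnergy m α ω '' {x | x ∉ collisionSet N ∧ threshold m α ω x = 0})

/-- The set `𝒦` in the phase space of pairs (collision-free configuration, velocity). -/
def setK (m : Fin N → ℝ) (α ω : ℝ) : Set (Config N × Config N) :=
  {p | p.1 ∉ collisionSet N ∧ energy m α p.1 p.2 < excitedEnergy m α ω ∧
    ‖angularMomentum m p.1 p.2‖ ≠ 0}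

/-- `𝒦₁⁺`: `|A| ≥ ω I` and `K_ω ≥ 0`. -/
def setK1p (m : Fin N → ℝ) (α ω : ℝ) : Set (Config N × Config N) :=
  {p | p ∈ setK m α ω ∧ ω * inertia m p.1 ≤ ‖angularMomentum m p.1 p.2‖ ∧
    0 ≤ threshold m α ω p.1}

/-- `𝒦₁⁻`: `|A| ≥ ω I` and `K_ω < 0`. -/
def setK1m (m : Fin N → ℝ) (α ω : ℝ) : Set (Config N × Config N) :=
  {p | p ∈ setK m α ω ∧ ω * inertia m p.1 ≤ ‖angularMomentum m p.1 p.2‖ ∧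
    threshold m α ω p.1 < 0}

/-- `𝒦₂⁺`: `|A| < ω I` and `K_ω ≥ 0`. -/
def setK2p (m : Fin N → ℝ) (α ω : ℝ) : Set (Config N × Config N) :=
  {p | p ∈ setK m α ω ∧ ‖angularMomentum m p.1 p.2‖ < ω * inertia m p.1 ∧
    0 ≤ threshold m α ω p.1}

/-- `𝒦₂⁻`: `|A| < ω I` and `K_ω < 0`. -/
def setK2m (m : Fin N → ℝ) (α ω : ℝ) : Set (Config N × Config N) :=
  {p | p ∈ setK m α ω ∧ ‖angularMomentum m p.1 p.2‖ < ω * inertia m p.1 ∧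
    threshold m α ω p.1 < 0}

end Functionals

/-- The time interval `[0, σ)`, where `σ` may be `+∞` (`⊤`). -/
def lifespan (σ : EReal) : Set ℝ := {t | 0 ≤ t ∧ (t : EReal) < σ}

/-- `z = (x, ẋ)` is a solution of the `N`-body equations `m_i ẍ_i = -∇_i U(x)` on `[0, σ)`,
with one-sided derivatives at time `0`; the values of `z` outside `[0, σ)` play no role. -/
structure IsSolution {N : ℕ} (m : Fin N → ℝ) (α : ℝ) (σ : EReal)
    (z : ℝ → Config N × Config N) : Prop where
  pos : 0 < σ
  noCollision : ∀ t ∈ lifespan σ, (z t).1 ∉ collisionSet N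
  velocity : ∀ t ∈ lifespan σ,
    HasDerivWithinAt (fun s => (z s).1) (z t).2 (Set.Ici 0) t
  acceleration : ∀ t ∈ lifespan σ,
    HasDerivWithinAt (fun s => (z s).2) (fun i => (m i)⁻¹ • force m α (z t).1 i) (Set.Ici 0) t

/-- A solution on `[0, σ)` that has no extension to a solution on a longer interval. -/
structure IsMaximalSolution {N : ℕ} (m : Fin N → ℝ) (α : ℝ) (σ : EReal)
    (z : ℝ → Config N × Config N) : Prop where
  isSolution : IsSolution m α σ z
  maximal : ∀ (σ' : EReal) (y : ℝ → Config N × Config N), IsSolution m α σ' y →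
    (∀ t ∈ lifespan σ, y t = z t) → σ' ≤ σ

/-- The solution experiences a collision (singularity): its maximal time `σ` is finite and the
configuration tends to a definite point of the collision set as `t → σ`. -/
def CollisionSingularity {N : ℕ} (σ : EReal) (z : ℝ → Config N × Config N) : Prop :=
  ∃ T : ℝ, σ = (T : EReal) ∧
    ∃ p ∈ collisionSet N, Filter.Tendsto (fun t => (z t).1) (𝓝[<] T) (𝓝 p)

/-- Infinitely many transitions between the sets `P` and `Q` of the phase space: there is an
infinite increasing sequence of times in `[0, σ)` at which `z` lies alternately in `P` and
in `Q`. -/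
def InfinitelyManyTransitions {N : ℕ} (σ : EReal) (z : ℝ → Config N × Config N)
    (P Q : Set (Config N × Config N)) : Prop :=
  ∃ τ : ℕ → ℝ, StrictMono τ ∧ (∀ n, τ n ∈ lifespan σ) ∧
    ∀ n, z (τ (2 * n)) ∈ P ∧ z (τ (2 * n + 1)) ∈ Q

end NBody

end

/-!
Energy `E` and angular momentum `A` are conserved, so everything is decided by the moment of
inertia `I` along a solution. Three facts carry the argument.

*Static inequalities.* Sundman's inequality gives `E ≥ E_ω` where `|A| ≥ ω I`, and scaling a
configuration until `K_ω = 0` gives `E* ≤ E_ω` where `K_ω ≥ 0` and `E* ≤ (α/2 - 1) |U|` where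
`K_ω ≤ 0`. Hence below `E*` the condition `|A| ≥ ω I` forces `K_ω < 0`
(`threshold_neg_of_inertia_le`), and by the Lagrange–Jacobi identity
`I'' = 4 E - (2 α - 4) |U| ≤ -4 (E* - E)` where `K_ω ≤ 0` (`virial_deriv_le`). So once `ω I` has
come down to `|A|` it stays below (`IsSolution.inertia_le_of_crossing`), and if `K_ω < 0` from
some time on, then the lifespan is finite, because `I` is uniformly concave and nonnegative.

*Collisions.* At a finite maximal time every limit point of the configuration is a collision
(`IsMaximalSolution.mem_collisionSet_of_mapClusterPt`); in particular `|U|` cannot stay bounded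
along a sequence of times, as it would where `K_ω ≥ 0`. If `I` is moreover concave and bounded, the
configuration converges (`exists_tendsto_of_concaveOn`). This is von Zeipel's theorem, and the proof
looks at a limit point `p` with the least number of colliding pairs. Near `p` the clusters of `p`
collapse, while their centers of mass have bounded acceleration, because internal forces cancel. A
solution that kept leaving a neighbourhood of `p` would cover a fixed distance in vanishing time
along an almost straight segment, and the parallelogram identity would make `I` at the midpoint
smaller than the mean of its values at the ends.

*Analyticity.* Infinitely many sign changes of `K_ω` could also accumulate at a time inside the
lifespan. This is impossible because collision-free motions are analytic in time: with finitely many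
auxiliary functions of the mutual distances the equations of motion become a quadratic differential
equation `y' = Q(y, y)`, and the Taylor coefficients of its solutions obey geometric bounds
(`analyticAt_of_quadratic`).
-/

namespace NBody

open Filter Set

variable {N : ℕ} {m : Fin N → ℝ} {α ω : ℝ}

/-! ### Algebra of the functionals -/

theorem sum_sum_Ioi_eq_half {f : Fin N → Fin N → ℝ} (hs : ∀ i j, f i j = f j i)
    (hd : ∀ i, f i i = 0) :
    ∑ i, ∑ j ∈ Finset.Ioi i, f i j = 1 / 2 * ∑ i, ∑ j, f i j := by
  have h := Finset.sum_sum_Ioi_add_eq_sum_sum_off_diag f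
  have h1 : ∀ i, ∑ j ∈ {i}ᶜ, f j i = ∑ j, f i j := by
    intro i
    rw [← Finset.sum_add_sum_compl {i} (fun j => f i j)]
    simp only [Finset.sum_singleton, hd, zero_add]
    exact Finset.sum_congr rfl fun j _ => hs j i
  have h2 : ∀ i, ∑ j ∈ Finset.Ioi i, (f j i + f i j) = 2 * ∑ j ∈ Finset.Ioi i, f i j := by
    intro i
    rw [Finset.mul_sum]
    exact Finset.sum_congr rfl fun j _ => by rw [hs j i]; ring
  simp only [h1, h2, ← Finset.mul_sum] at h
  linarith

/-- The sum over pairs written symmetrically. The diagonal terms vanish because of the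
conventions `0 ^ α = 0` and `a / 0 = 0`. -/
theorem potential_eq (m : Fin N → ℝ) (hα : α ≠ 0) (x : Config N) :
    potential m α x = -(1 / 2 * ∑ i, ∑ j, m i * m j / ‖x i - x j‖ ^ α) := by
  unfold potential
  rw [sum_sum_Ioi_eq_half]
  · intro i j
    rw [norm_sub_rev, mul_comm]
  · intro i
    simp [Real.zero_rpow hα]

theorem force_eq (m : Fin N → ℝ) (α : ℝ) (x : Config N) (i : Fin N) :
    force m α x i = -∑ j, (α * (m i * m j) / ‖x i - x j‖ ^ (α + 2)) • (x i - x j) := by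
  unfold force
  rw [← Finset.add_sum_erase Finset.univ _ (Finset.mem_univ i)]
  simp

theorem pair_le_neg_potential (hm : ∀ i, 0 < m i) {x : Config N} {i j : Fin N} (hij : i ≠ j) :
    m i * m j / ‖x i - x j‖ ^ α ≤ -potential m α x := by
  have hnn : ∀ i j : Fin N, 0 ≤ m i * m j / ‖x i - x j‖ ^ α := fun i j => by
    have := hm i; have := hm j; positivity
  unfold potential
  rw [neg_neg]
  have key : ∀ i j : Fin N, i < j → m i * m j / ‖x i - x j‖ ^ α ≤
      ∑ i, ∑ j ∈ Finset.Ioi i, m i * m j / ‖x i - x j‖ ^ α := by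
    intro i j h
    calc m i * m j / ‖x i - x j‖ ^ α ≤ ∑ j ∈ Finset.Ioi i, m i * m j / ‖x i - x j‖ ^ α :=
          Finset.single_le_sum (f := fun j => m i * m j / ‖x i - x j‖ ^ α)
            (fun j _ => hnn i j) (Finset.mem_Ioi.2 h)
      _ ≤ _ := Finset.single_le_sum
            (f := fun i => ∑ j ∈ Finset.Ioi i, m i * m j / ‖x i - x j‖ ^ α)
            (fun i _ => Finset.sum_nonneg fun j _ => hnn i j) (Finset.mem_univ i)
  rcases lt_or_gt_of_ne hij with h | h
  · exact key i j h
  · rw [norm_sub_rev, mul_comm]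
    exact key j i h

theorem dist_pos_of_notMem {x : Config N} (hx : x ∉ collisionSet N) {i j : Fin N} (hij : i ≠ j) :
    0 < ‖x i - x j‖ := by
  rw [norm_pos_iff, sub_ne_zero]
  exact fun h => hx ⟨i, j, hij, h⟩

theorem potential_neg (hN : 2 ≤ N) (hm : ∀ i, 0 < m i) {x : Config N}
    (hx : x ∉ collisionSet N) : potential m α x < 0 := by
  have hij : (⟨0, by omega⟩ : Fin N) ≠ ⟨1, by omega⟩ := by simp
  have h := pair_le_neg_potential (α := α) hm (x := x) hij
  have h1 := dist_pos_of_notMem hx hij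
  have h2 : 0 < m ⟨0, by omega⟩ * m ⟨1, by omega⟩ /
      ‖x ⟨0, by omega⟩ - x ⟨1, by omega⟩‖ ^ α :=
    div_pos (mul_pos (hm _) (hm _)) (Real.rpow_pos_of_pos h1 _)
  linarith

theorem inertia_nonneg (hm : ∀ i, 0 < m i) (x : Config N) : 0 ≤ inertia m x :=
  Finset.sum_nonneg fun i _ => mul_nonneg (hm i).le (sq_nonneg _)

theorem term_le_inertia (hm : ∀ i, 0 < m i) (x : Config N) (i : Fin N) :
    m i * ‖x i‖ ^ 2 ≤ inertia m x :=
  Finset.single_le_sum (f := fun i => m i * ‖x i‖ ^ 2)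
    (fun i _ => mul_nonneg (hm i).le (sq_nonneg _)) (Finset.mem_univ i)

theorem inertia_pos (hN : 2 ≤ N) (hm : ∀ i, 0 < m i) {x : Config N}
    (hx : x ∉ collisionSet N) : 0 < inertia m x := by
  by_contra h
  have h0 : ∀ i, x i = 0 := by
    intro i
    have := term_le_inertia hm x i
    have h2 : m i * ‖x i‖ ^ 2 ≤ 0 := by linarith
    have h3 : ‖x i‖ ^ 2 ≤ 0 := by
      by_contra h4
      exact absurd h2 (not_le.2 (mul_pos (hm i) (not_le.1 h4)))
    have h4 : ‖x i‖ = 0 := by nlinarith [norm_nonneg (x i)]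
    exact norm_eq_zero.1 h4
  exact hx ⟨⟨0, by omega⟩, ⟨1, by omega⟩, by simp, by rw [h0, h0]⟩

theorem smul_notMem_collisionSet {x : Config N} (hx : x ∉ collisionSet N) {l : ℝ} (hl : 0 < l) :
    l • x ∉ collisionSet N := by
  rintro ⟨i, j, hij, h⟩
  exact hx ⟨i, j, hij, smul_right_injective _ hl.ne' h⟩

theorem inertia_smul (m : Fin N → ℝ) (x : Config N) (l : ℝ) :
    inertia m (l • x) = l ^ 2 * inertia m x := by
  unfold inertia
  rw [Finset.mul_sum]
  refine Finset.sum_congr rfl fun i _ => ?_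
  rw [Pi.smul_apply, norm_smul, mul_pow, Real.norm_eq_abs, sq_abs]
  ring

theorem potential_smul (m : Fin N → ℝ) (α : ℝ) (x : Config N) {l : ℝ} (hl : 0 < l) :
    potential m α (l • x) = potential m α x / l ^ α := by
  unfold potential
  rw [neg_div, Finset.sum_div]
  congr 1
  refine Finset.sum_congr rfl fun i _ => ?_
  rw [Finset.sum_div]
  refine Finset.sum_congr rfl fun j _ => ?_
  rw [Pi.smul_apply, Pi.smul_apply, ← smul_sub, norm_smul, Real.norm_of_nonneg hl.le,
    Real.mul_rpow hl.le (norm_nonneg _), div_div, mul_comm (l ^ α)]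

/-! ### The excited energy along rays -/

theorem bddBelow_excited (hα : 2 < α) (hm : ∀ i, 0 < m i) :
    BddBelow (rotatingEnergy m α ω '' {x | x ∉ collisionSet N ∧ threshold m α ω x = 0}) := by
  refine ⟨0, ?_⟩
  rintro _ ⟨x, ⟨-, hK⟩, rfl⟩
  unfold threshold at hK
  unfold rotatingEnergy
  have h1 := mul_nonneg (sq_nonneg ω) (inertia_nonneg hm x)
  have h2 : potential m α x = -(ω ^ 2 * inertia m x) / α := by
    field_simp
    linarith
  have h3 : ω ^ 2 / 2 * inertia m x + potential m α x =
      (ω ^ 2 * inertia m x) * (1 / 2 - 1 / α) := by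
    rw [h2]; ring
  rw [h3]
  refine mul_nonneg h1 ?_
  rw [sub_nonneg]
  exact one_div_le_one_div_of_le (by norm_num) hα.le

/-- Every ray contains a configuration with `K_ω = 0`; its position on the ray tells the sign of
`K_ω` at the starting point. -/
theorem exists_smul_threshold_eq_zero (hN : 2 ≤ N) (hm : ∀ i, 0 < m i) (hα : 2 < α) (hω : 0 < ω)
    {x : Config N} (hx : x ∉ collisionSet N) :
    ∃ l : ℝ, 0 < l ∧ threshold m α ω (l • x) = 0 ∧
      (0 ≤ threshold m α ω x → l ≤ 1) ∧ (threshold m α ω x ≤ 0 → 1 ≤ l) := by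
  have hU := potential_neg (α := α) hN hm hx
  have hI := inertia_pos hN hm hx
  have hα0 : 0 < α := by linarith
  set U := potential m α x with hUdef
  set J := inertia m x with hJdef
  have hp : 0 < ω ^ 2 * J := by positivity
  have hq : 0 < α * -U := mul_pos hα0 (by linarith)
  have hr : 0 < α * -U / (ω ^ 2 * J) := div_pos hq hp
  have he : 0 < (α + 2)⁻¹ := by positivity
  refine ⟨(α * -U / (ω ^ 2 * J)) ^ (α + 2)⁻¹, Real.rpow_pos_of_pos hr _, ?_, ?_, ?_⟩
  · set l := (α * -U / (ω ^ 2 * J)) ^ (α + 2)⁻¹ with hl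
    have hl0 : 0 < l := Real.rpow_pos_of_pos hr _
    have h1 : l ^ (α + 2) = α * -U / (ω ^ 2 * J) := by
      rw [hl, ← Real.rpow_mul hr.le, inv_mul_cancel₀ (by linarith), Real.rpow_one]
    have h2 : l ^ (α + 2) = l ^ α * l ^ 2 := by
      rw [Real.rpow_add hl0]; norm_num
    have hla : 0 < l ^ α := Real.rpow_pos_of_pos hl0 _
    unfold threshold
    rw [inertia_smul, potential_smul m α x hl0, ← hUdef, ← hJdef]
    have h3 : l ^ α * l ^ 2 * (ω ^ 2 * J) = α * -U := by
      rw [← h2, h1]; field_simp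
    field_simp
    linarith
  · intro h
    unfold threshold at h
    refine Real.rpow_le_one hr.le ?_ he.le
    rw [div_le_one hp]
    linarith
  · intro h
    unfold threshold at h
    refine Real.one_le_rpow ?_ he.le
    rw [le_div_iff₀ hp]
    linarith

/-- `E*(ω) ≤ E_ω(x)` if `K_ω(x) ≥ 0`: shrink `x` until `K_ω = 0`. -/
theorem excitedEnergy_le_rotatingEnergy (hN : 2 ≤ N) (hm : ∀ i, 0 < m i) (hα : 2 < α)
    (hω : 0 < ω) {x : Config N} (hx : x ∉ collisionSet N) (hK : 0 ≤ threshold m α ω x) :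
    excitedEnergy m α ω ≤ rotatingEnergy m α ω x := by
  obtain ⟨l, hl0, hl, h1, -⟩ := exists_smul_threshold_eq_zero hN hm hα hω hx
  refine (csInf_le (bddBelow_excited hα hm)
    ⟨l • x, ⟨smul_notMem_collisionSet hx hl0, hl⟩, rfl⟩).trans ?_
  have hl1 := h1 hK
  have hα0 : 0 < α := by linarith
  unfold threshold at hl hK
  unfold rotatingEnergy
  have hI := inertia_nonneg hm x
  have hp : 0 ≤ ω ^ 2 * inertia m x := by positivity
  rw [inertia_smul] at *
  set W := potential m α (l • x)
  have hW : W = -(ω ^ 2 * inertia m x) * l ^ 2 / α := by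
    field_simp; linarith
  have hU : -(ω ^ 2 * inertia m x) / α ≤ potential m α x := by
    rw [div_le_iff₀ hα0]; linarith
  have h5 : l ^ 2 ≤ 1 := by nlinarith
  have h6 : 0 ≤ 1 / 2 - 1 / α := by
    rw [sub_nonneg]
    exact one_div_le_one_div_of_le (by norm_num) hα.le
  have h7 : ω ^ 2 / 2 * (l ^ 2 * inertia m x) + W =
      (ω ^ 2 * inertia m x) * (1 / 2 - 1 / α) * l ^ 2 := by rw [hW]; ring
  have h8 : (ω ^ 2 * inertia m x) * (1 / 2 - 1 / α) * l ^ 2 ≤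
      (ω ^ 2 * inertia m x) * (1 / 2 - 1 / α) :=
    mul_le_of_le_one_right (mul_nonneg hp h6) h5
  have h9 : (ω ^ 2 * inertia m x) * (1 / 2 - 1 / α) =
      ω ^ 2 / 2 * inertia m x + -(ω ^ 2 * inertia m x) / α := by ring
  linarith

/-- `E*(ω) ≤ (α/2 - 1) |U(x)|` if `K_ω(x) ≤ 0`: dilate `x` until `K_ω = 0`. By the
Lagrange–Jacobi identity this makes the moment of inertia strictly concave below `E*(ω)`. -/
theorem excitedEnergy_le_of_threshold_nonpos (hN : 2 ≤ N) (hm : ∀ i, 0 < m i) (hα : 2 < α)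
    (hω : 0 < ω) {x : Config N} (hx : x ∉ collisionSet N) (hK : threshold m α ω x ≤ 0) :
    excitedEnergy m α ω ≤ (α / 2 - 1) * -potential m α x := by
  obtain ⟨l, hl0, hl, -, h1⟩ := exists_smul_threshold_eq_zero hN hm hα hω hx
  refine (csInf_le (bddBelow_excited hα hm)
    ⟨l • x, ⟨smul_notMem_collisionSet hx hl0, hl⟩, rfl⟩).trans ?_
  have hl1 := h1 hK
  unfold threshold at hl
  unfold rotatingEnergy
  have hU := potential_neg (α := α) hN hm hx
  have hla : 1 ≤ l ^ α := Real.one_le_rpow hl1 (by linarith)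
  have h2 : -potential m α (l • x) ≤ -potential m α x := by
    rw [potential_smul m α x hl0, ← neg_div]
    exact div_le_self (by linarith) hla
  have h3 : ω ^ 2 / 2 * inertia m (l • x) + potential m α (l • x) =
      (α / 2 - 1) * -potential m α (l • x) := by
    linear_combination hl / 2
  rw [h3]
  exact mul_le_mul_of_nonneg_left h2 (by linarith)

/-! ### Sundman's inequality -/

theorem norm_cross_le (a b : EuclideanSpace ℝ (Fin 3)) : ‖cross a b‖ ≤ ‖a‖ * ‖b‖ := by
  have h : ‖cross a b‖ ^ 2 ≤ (‖a‖ * ‖b‖) ^ 2 := by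
    rw [mul_pow, EuclideanSpace.norm_sq_eq, EuclideanSpace.norm_sq_eq, EuclideanSpace.norm_sq_eq]
    simp only [Fin.sum_univ_three, Real.norm_eq_abs, sq_abs, cross, cross_apply]
    simp only [Matrix.cons_val_zero, Matrix.cons_val_one, Matrix.cons_val]
    nlinarith [sq_nonneg (a 0 * b 0 + a 1 * b 1 + a 2 * b 2)]
  exact le_of_sq_le_sq h (by positivity)

/-- Sundman's inequality `|A|² ≤ I · ∑ m_i |v_i|²`. -/
theorem sundman (hm : ∀ i, 0 < m i) (x v : Config N) :
    ‖angularMomentum m x v‖ ^ 2 ≤ inertia m x * ∑ i, m i * ‖v i‖ ^ 2 := by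
  have h1 : ‖angularMomentum m x v‖ ≤
      ∑ i, (Real.sqrt (m i) * ‖x i‖) * (Real.sqrt (m i) * ‖v i‖) := by
    refine (norm_sum_le _ _).trans (Finset.sum_le_sum fun i _ => ?_)
    rw [norm_smul, Real.norm_of_nonneg (hm i).le]
    calc m i * ‖cross (x i) (v i)‖ ≤ m i * (‖x i‖ * ‖v i‖) :=
          mul_le_mul_of_nonneg_left (norm_cross_le _ _) (hm i).le
      _ = (Real.sqrt (m i) * Real.sqrt (m i)) * (‖x i‖ * ‖v i‖) := by
          rw [Real.mul_self_sqrt (hm i).le]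
      _ = _ := by ring
  calc ‖angularMomentum m x v‖ ^ 2 ≤
      (∑ i, (Real.sqrt (m i) * ‖x i‖) * (Real.sqrt (m i) * ‖v i‖)) ^ 2 :=
        pow_le_pow_left₀ (norm_nonneg _) h1 2
    _ ≤ (∑ i, (Real.sqrt (m i) * ‖x i‖) ^ 2) * ∑ i, (Real.sqrt (m i) * ‖v i‖) ^ 2 :=
        Finset.sum_mul_sq_le_sq_mul_sq _ _ _
    _ = _ := by
        unfold inertia
        simp only [mul_pow, Real.sq_sqrt (hm _).le]

/-- If `|A| ≥ ω I`, the energy dominates `E_ω`. -/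
theorem rotatingEnergy_le_energy (hN : 2 ≤ N) (hm : ∀ i, 0 < m i) (hω : 0 < ω) {x v : Config N}
    (hx : x ∉ collisionSet N) (hA : ω * inertia m x ≤ ‖angularMomentum m x v‖) :
    rotatingEnergy m α ω x ≤ energy m α x v := by
  have hI := inertia_pos hN hm hx
  have h1 := sundman hm x v
  unfold rotatingEnergy energy
  have h2 : (ω * inertia m x) ^ 2 ≤ inertia m x * ∑ i, m i * ‖v i‖ ^ 2 :=
    (pow_le_pow_left₀ (by positivity) hA 2).trans h1
  have h3 : ω ^ 2 * inertia m x ≤ ∑ i, m i * ‖v i‖ ^ 2 := by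
    refine le_of_mul_le_mul_left ?_ hI
    calc inertia m x * (ω ^ 2 * inertia m x) = (ω * inertia m x) ^ 2 := by ring
      _ ≤ _ := h2
  linarith

/-- Below the excited energy, `|A| ≥ ω I` forces `K_ω < 0`. -/
theorem threshold_neg_of_inertia_le (hN : 2 ≤ N) (hm : ∀ i, 0 < m i) (hα : 2 < α) (hω : 0 < ω)
    {p : Config N × Config N} (hp : p ∈ setK m α ω)
    (hA : ω * inertia m p.1 ≤ ‖angularMomentum m p.1 p.2‖) : threshold m α ω p.1 < 0 := by
  by_contra h
  have h1 := excitedEnergy_le_rotatingEnergy hN hm hα hω hp.1 (not_lt.1 h)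
  have h2 := rotatingEnergy_le_energy (α := α) hN hm hω hp.1 hA
  exact absurd hp.2.1 (not_lt.2 (h1.trans h2))

/-! ### Conservation laws and the Lagrange–Jacobi identity -/

/-- The acceleration field of the `N`-body problem. -/
noncomputable def acc (m : Fin N → ℝ) (α : ℝ) (x : Config N) : Config N :=
  fun i => (m i)⁻¹ • force m α x i

/-- Half the time derivative of the moment of inertia, `∑ m_i ⟨x_i, v_i⟩`. -/
noncomputable def virial (m : Fin N → ℝ) (x v : Config N) : ℝ :=
  ∑ i, m i * inner ℝ (x i) (v i)

/-- The cross product as a continuous bilinear map. -/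
noncomputable def crossL :
    EuclideanSpace ℝ (Fin 3) →L[ℝ] EuclideanSpace ℝ (Fin 3) →L[ℝ] EuclideanSpace ℝ (Fin 3) :=
  LinearMap.toContinuousBilinearMap <| LinearMap.mk₂ ℝ cross
    (fun a b c => by simp [cross]) (fun r a b => by simp [cross])
    (fun a b c => by simp [cross]) (fun r a b => by simp [cross])

theorem crossL_apply (a b : EuclideanSpace ℝ (Fin 3)) : crossL a b = cross a b := rfl

theorem cross_self_eq_zero (a : EuclideanSpace ℝ (Fin 3)) : cross a a = 0 := by
  simp [cross]

theorem crossL_swap (a b : EuclideanSpace ℝ (Fin 3)) : crossL a b = -crossL b a := by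
  change WithLp.toLp 2 _ = -WithLp.toLp 2 _
  rw [← cross_anticomm, WithLp.toLp_neg]

/-- The power of the forces along `w`, symmetrized over pairs by Newton's third law. -/
theorem sum_inner_force (m : Fin N → ℝ) (α : ℝ) (x w : Config N) :
    ∑ i, inner ℝ (force m α x i) (w i) = -(1 / 2 * ∑ i, ∑ j,
      α * (m i * m j) / ‖x i - x j‖ ^ (α + 2) * inner ℝ (x i - x j) (w i - w j)) := by
  set c : Fin N → Fin N → ℝ := fun i j => α * (m i * m j) / ‖x i - x j‖ ^ (α + 2) with hc
  have hcs : ∀ i j, c i j = c j i := fun i j => by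
    simp only [hc]; rw [norm_sub_rev, mul_comm (m i)]
  have h1 : ∑ i, inner ℝ (force m α x i) (w i) = -∑ i, ∑ j, c i j * inner ℝ (x i - x j) (w i) := by
    rw [← Finset.sum_neg_distrib]
    refine Finset.sum_congr rfl fun i _ => ?_
    rw [force_eq, inner_neg_left, sum_inner]
    simp only [real_inner_smul_left, hc]
  have h2 : ∑ i, ∑ j, c i j * inner ℝ (x i - x j) (w j) =
      -∑ i, ∑ j, c i j * inner ℝ (x i - x j) (w i) := by
    rw [Finset.sum_comm, ← Finset.sum_neg_distrib]
    refine Finset.sum_congr rfl fun i _ => ?_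
    rw [← Finset.sum_neg_distrib]
    refine Finset.sum_congr rfl fun j _ => ?_
    rw [hcs, ← neg_sub, inner_neg_left]
    ring
  have h3 : ∑ i, ∑ j, c i j * inner ℝ (x i - x j) (w i - w j) =
      ∑ i, ∑ j, c i j * inner ℝ (x i - x j) (w i) -
        ∑ i, ∑ j, c i j * inner ℝ (x i - x j) (w j) := by
    simp only [inner_sub_right, mul_sub, Finset.sum_sub_distrib]
  change _ = -(1 / 2 * ∑ i, ∑ j, c i j * inner ℝ (x i - x j) (w i - w j))
  rw [h3, h1, h2]
  ring

/-- Euler's identity for the homogeneous potential. -/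
theorem sum_inner_force_self (m : Fin N → ℝ) (hα : 0 < α) (x : Config N) :
    ∑ i, inner ℝ (force m α x i) (x i) = α * potential m α x := by
  rw [sum_inner_force, potential_eq m hα.ne']
  rw [mul_neg, mul_left_comm α, Finset.mul_sum (a := α)]
  congr 2
  refine Finset.sum_congr rfl fun i _ => ?_
  rw [Finset.mul_sum]
  refine Finset.sum_congr rfl fun j _ => ?_
  rw [real_inner_self_eq_norm_sq]
  rcases (norm_nonneg (x i - x j)).eq_or_lt with h | h
  · rw [← h, Real.zero_rpow hα.ne', Real.zero_rpow (by linarith)]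
    simp
  · have h2 : ‖x i - x j‖ ^ (α + 2) = ‖x i - x j‖ ^ α * ‖x i - x j‖ ^ 2 := by
      rw [Real.rpow_add h]; norm_num
    rw [h2]
    have := (Real.rpow_pos_of_pos h α).ne'
    field_simp

/-- The total torque of the forces vanishes. -/
theorem sum_cross_force (m : Fin N → ℝ) (α : ℝ) (x : Config N) :
    ∑ i, crossL (x i) (force m α x i) = 0 := by
  set c : Fin N → Fin N → ℝ := fun i j => α * (m i * m j) / ‖x i - x j‖ ^ (α + 2) with hc
  have hcs : ∀ i j, c i j = c j i := fun i j => by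
    simp only [hc]; rw [norm_sub_rev, mul_comm (m i)]
  have h1 : ∑ i, crossL (x i) (force m α x i) = ∑ i, ∑ j, c i j • crossL (x i) (x j) := by
    refine Finset.sum_congr rfl fun i _ => ?_
    rw [force_eq, map_neg, map_sum, ← Finset.sum_neg_distrib]
    refine Finset.sum_congr rfl fun j _ => ?_
    rw [map_smul, map_sub, crossL_apply (x i) (x i), cross_self_eq_zero, zero_sub, smul_neg,
      neg_neg]
  have h2 : ∑ i, ∑ j, c i j • crossL (x i) (x j) = -∑ i, ∑ j, c i j • crossL (x i) (x j) := by
    conv_lhs => rw [Finset.sum_comm]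
    rw [← Finset.sum_neg_distrib]
    refine Finset.sum_congr rfl fun i _ => ?_
    rw [← Finset.sum_neg_distrib]
    refine Finset.sum_congr rfl fun j _ => ?_
    rw [hcs, crossL_swap, smul_neg]
  rw [h1]
  have h3 : (2 : ℝ) • ∑ i, ∑ j, c i j • crossL (x i) (x j) = 0 := by
    rw [two_smul]
    nth_rewrite 1 [h2]
    exact neg_add_cancel _
  exact (smul_eq_zero.1 h3).resolve_left two_ne_zero

theorem hasDerivWithinAt_norm_rpow {d : ℝ → EuclideanSpace ℝ (Fin 3)}
    {d' : EuclideanSpace ℝ (Fin 3)} {S : Set ℝ} {t : ℝ} (hd : HasDerivWithinAt d d' S t)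
    (h0 : d t ≠ 0) (β : ℝ) :
    HasDerivWithinAt (fun s => ‖d s‖ ^ β) (β * ‖d t‖ ^ (β - 2) * inner ℝ (d t) d') S t := by
  have e : ∀ (s : ℝ) (γ : ℝ), (‖d s‖ ^ 2) ^ γ = ‖d s‖ ^ (2 * γ) := fun s γ => by
    rw [← Real.rpow_natCast, ← Real.rpow_mul (norm_nonneg _)]; norm_num
  have h := hd.norm_sq.rpow_const (p := β / 2) (Or.inl (by positivity))
  have h2 : (fun s => ‖d s‖ ^ β) = fun s => (‖d s‖ ^ 2) ^ (β / 2) := by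
    funext s; rw [e]; congr 1; ring
  rw [h2]
  convert h using 1
  rw [e, show 2 * (β / 2 - 1) = β - 2 by ring]
  ring

section Derivatives

variable {x v : ℝ → Config N} {S : Set ℝ} {t : ℝ}

theorem hasDerivWithinAt_coord {y : ℝ → Config N} {y' : Config N}
    (h : HasDerivWithinAt y y' S t) (i : Fin N) :
    HasDerivWithinAt (fun s => y s i) (y' i) S t :=
  (hasDerivWithinAt_pi.1 h) i

theorem hasDerivWithinAt_inertia (hx : HasDerivWithinAt x (v t) S t) :
    HasDerivWithinAt (fun s => inertia m (x s)) (2 * virial m (x t) (v t)) S t := by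
  unfold inertia virial
  rw [Finset.mul_sum]
  refine HasDerivWithinAt.fun_sum fun i _ => ?_
  exact ((hasDerivWithinAt_coord hx i).norm_sq.const_mul (m i)).congr_deriv (by ring)

theorem hasDerivWithinAt_potential (hα : 0 < α) (hx : HasDerivWithinAt x (v t) S t)
    (hc : x t ∉ collisionSet N) :
    HasDerivWithinAt (fun s => potential m α (x s))
      (-∑ i, inner ℝ (force m α (x t) i) (v t i)) S t := by
  rw [sum_inner_force, neg_neg]
  simp only [potential_eq m hα.ne']
  have key : ∀ i j : Fin N, HasDerivWithinAt (fun s => m i * m j / ‖x s i - x s j‖ ^ α)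
      (-(α * (m i * m j) / ‖x t i - x t j‖ ^ (α + 2) *
        inner ℝ (x t i - x t j) (v t i - v t j))) S t := by
    intro i j
    rcases eq_or_ne i j with rfl | hij
    · simpa using hasDerivWithinAt_const t S (m i * m i / (0 : ℝ) ^ α)
    · have hd := (hasDerivWithinAt_coord hx i).sub (hasDerivWithinAt_coord hx j)
      have hp := dist_pos_of_notMem hc hij
      have h := (hasDerivWithinAt_norm_rpow hd (norm_pos_iff.1 hp) (-α)).const_mul (m i * m j)
      simp only [Pi.sub_apply] at h
      refine (h.congr_deriv ?_).congr_of_eventuallyEq ?_ ?_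
      · rw [show -α - 2 = -(α + 2) by ring, Real.rpow_neg hp.le]
        ring
      · filter_upwards with s
        rw [Real.rpow_neg (norm_nonneg _), div_eq_mul_inv]
      · rw [Real.rpow_neg (norm_nonneg _), div_eq_mul_inv]
  have h := ((HasDerivWithinAt.fun_sum (u := Finset.univ) fun i _ =>
    HasDerivWithinAt.fun_sum (u := Finset.univ) fun j _ => key i j).const_mul (1 / 2)).fun_neg
  refine h.congr_deriv ?_
  simp only [Finset.sum_neg_distrib]
  ring

theorem mul_inner_acc (hm : ∀ i, 0 < m i) (x w : Config N) (i : Fin N) :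
    m i * inner ℝ (w i) (acc m α x i) = inner ℝ (force m α x i) (w i) := by
  unfold acc
  rw [real_inner_smul_right, real_inner_comm, mul_inv_cancel_left₀ (hm i).ne']

/-- The Lagrange–Jacobi identity. -/
theorem hasDerivWithinAt_virial (hm : ∀ i, 0 < m i) (hα : 0 < α)
    (hx : HasDerivWithinAt x (v t) S t) (hv : HasDerivWithinAt v (acc m α (x t)) S t) :
    HasDerivWithinAt (fun s => virial m (x s) (v s))
      (2 * energy m α (x t) (v t) + (α - 2) * potential m α (x t)) S t := by
  have h : HasDerivWithinAt (fun s => virial m (x s) (v s))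
      (∑ i, m i * (inner ℝ (x t i) (acc m α (x t) i) + inner ℝ (v t i) (v t i))) S t := by
    unfold virial
    exact HasDerivWithinAt.fun_sum fun i _ =>
      ((hasDerivWithinAt_coord hx i).inner ℝ (hasDerivWithinAt_coord hv i)).const_mul (m i)
  refine h.congr_deriv ?_
  simp only [mul_add, Finset.sum_add_distrib, mul_inner_acc hm]
  rw [sum_inner_force_self m hα]
  unfold energy
  simp only [real_inner_self_eq_norm_sq]
  ring

theorem hasDerivWithinAt_energy (hm : ∀ i, 0 < m i) (hα : 0 < α)
    (hx : HasDerivWithinAt x (v t) S t) (hv : HasDerivWithinAt v (acc m α (x t)) S t)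
    (hc : x t ∉ collisionSet N) :
    HasDerivWithinAt (fun s => energy m α (x s) (v s)) 0 S t := by
  have h1 : HasDerivWithinAt (fun s => ∑ i, m i * ‖v s i‖ ^ 2)
      (∑ i, m i * (2 * inner ℝ (v t i) (acc m α (x t) i))) S t :=
    HasDerivWithinAt.fun_sum fun i _ => (hasDerivWithinAt_coord hv i).norm_sq.const_mul (m i)
  have h := (h1.const_mul (1 / 2)).fun_add (hasDerivWithinAt_potential (m := m) hα hx hc)
  refine h.congr_deriv ?_
  simp only [mul_left_comm _ (2 : ℝ), mul_inner_acc hm, ← Finset.mul_sum]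
  ring

theorem hasDerivWithinAt_angularMomentum (hm : ∀ i, 0 < m i)
    (hx : HasDerivWithinAt x (v t) S t) (hv : HasDerivWithinAt v (acc m α (x t)) S t) :
    HasDerivWithinAt (fun s => angularMomentum m (x s) (v s)) 0 S t := by
  have h : HasDerivWithinAt (fun s => angularMomentum m (x s) (v s))
      (∑ i, m i • (crossL (x t i) (acc m α (x t) i) + crossL (v t i) (v t i))) S t := by
    unfold angularMomentum
    exact HasDerivWithinAt.fun_sum fun i _ =>
      (crossL.hasDerivWithinAt_of_bilinear (hasDerivWithinAt_coord hx i)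
        (hasDerivWithinAt_coord hv i)).const_smul (m i)
  refine h.congr_deriv ?_
  rw [← sum_cross_force m α (x t)]
  refine Finset.sum_congr rfl fun i _ => ?_
  rw [crossL_apply (v t i), cross_self_eq_zero, add_zero, acc, map_smul,
    smul_inv_smul₀ (hm i).ne']

end Derivatives

/-! ### First and last hitting times -/

/-- The first time at which a continuous function reaches the level `ρ` from below. -/
theorem exists_first_hit {g : ℝ → ℝ} {a b ρ : ℝ} (hab : a ≤ b) (hg : ContinuousOn g (Icc a b))
    (ha : g a < ρ) (hb : ρ ≤ g b) : ∃ c ∈ Ioc a b, g c = ρ ∧ ∀ t ∈ Ico a c, g t < ρ := by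
  have hcl : IsCompact (Icc a b ∩ g ⁻¹' Ici ρ) :=
    (isCompact_Icc).of_isClosed_subset (hg.preimage_isClosed_of_isClosed isClosed_Icc isClosed_Ici)
      inter_subset_left
  obtain ⟨c, ⟨hc, hcρ⟩, hmin⟩ := hcl.exists_isLeast ⟨b, right_mem_Icc.2 hab, hb⟩
  have hlt : ∀ t ∈ Ico a c, g t < ρ := fun t ht => by
    by_contra h
    exact absurd (hmin ⟨⟨ht.1, ht.2.le.trans hc.2⟩, not_lt.1 h⟩) (not_le.2 ht.2)
  have hac : a < c := lt_of_le_of_ne hc.1 (by rintro rfl; exact absurd hcρ (not_le.2 ha))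
  refine ⟨c, ⟨hac, hc.2⟩, le_antisymm ?_ hcρ, hlt⟩
  obtain ⟨s, hs, hsρ⟩ := intermediate_value_Icc hac.le
    (hg.mono (Icc_subset_Icc_right hc.2)) ⟨ha.le, hcρ⟩
  rcases hs.2.eq_or_lt with rfl | h
  · exact hsρ.le
  · exact absurd hsρ (hlt s ⟨hs.1, h⟩).ne

/-- The last time at which a continuous function that ends above the level `ρ` takes that value. -/
theorem exists_last_hit {g : ℝ → ℝ} {a b ρ : ℝ} (hab : a ≤ b) (hg : ContinuousOn g (Icc a b))
    (ha : g a ≤ ρ) (hb : ρ < g b) : ∃ c ∈ Ico a b, g c = ρ ∧ ∀ t ∈ Ioc c b, ρ < g t := by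
  have hc : ContinuousOn (fun t => -g (-t)) (Icc (-b) (-a)) :=
    (hg.comp continuousOn_neg (fun t ht => ⟨by linarith [ht.2], by linarith [ht.1]⟩)).neg
  obtain ⟨c, hc, h1, h2⟩ := exists_first_hit (ρ := -ρ) (neg_le_neg hab) hc
    (by simpa using hb) (by simpa using ha)
  refine ⟨-c, ⟨by linarith [hc.2], by linarith [hc.1]⟩, by linarith, fun t ht => ?_⟩
  have := h2 (-t) ⟨by linarith [ht.2], by linarith [ht.1]⟩
  rw [neg_neg] at this
  linarith

/-! ### Continuation of solutions -/

theorem isClosed_collisionSet (N : ℕ) : IsClosed (collisionSet N) := by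
  have : collisionSet N = ⋃ i : Fin N, ⋃ j : Fin N, {x | i ≠ j ∧ x i = x j} := by
    ext x; simp [collisionSet]
  rw [this]
  refine isClosed_iUnion_of_finite fun i => isClosed_iUnion_of_finite fun j => ?_
  by_cases h : i = j
  · simp [h]
  · simp only [ne_eq, h, not_false_eq_true, true_and]
    exact isClosed_eq (continuous_apply i) (continuous_apply j)

theorem continuousAt_potential (m : Fin N → ℝ) (α : ℝ) {x : Config N}
    (hx : x ∉ collisionSet N) : ContinuousAt (potential m α) x := by
  unfold potential
  refine (tendsto_finsetSum _ fun i _ => tendsto_finsetSum _ fun j hj => ?_).neg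
  have hp := dist_pos_of_notMem hx (Finset.mem_Ioi.1 hj).ne
  have h1 : ContinuousAt (fun y : Config N => ‖y i - y j‖) x :=
    (continuous_norm.comp ((continuous_apply i).sub (continuous_apply j))).continuousAt
  exact continuousAt_const.div (h1.rpow_const (Or.inl hp.ne')) (Real.rpow_pos_of_pos hp _).ne'

theorem contDiffAt_acc (m : Fin N → ℝ) (α : ℝ) {x : Config N}
    (hx : x ∉ collisionSet N) : ContDiffAt ℝ 1 (acc m α) x := by
  unfold acc force
  refine contDiffAt_pi.2 fun i => ContDiffAt.const_smul _ (ContDiffAt.neg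
    (ContDiffAt.sum fun j hj => ?_))
  have hp := dist_pos_of_notMem hx (Finset.ne_of_mem_erase hj).symm
  have h1 : ContDiffAt ℝ 1 (fun y : Config N => y i - y j) x :=
    ((contDiff_apply ℝ _ i).sub (contDiff_apply ℝ _ j)).contDiffAt
  exact (contDiffAt_const.div ((h1.norm ℝ (norm_pos_iff.1 hp)).rpow_const_of_ne hp.ne')
    (Real.rpow_pos_of_pos hp _).ne').smul h1

/-- The vector field of the `N`-body problem on phase space. -/
noncomputable def field (m : Fin N → ℝ) (α : ℝ) (p : Config N × Config N) :
    Config N × Config N := (p.2, acc m α p.1)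

theorem contDiffAt_field (m : Fin N → ℝ) (α : ℝ) {p : Config N × Config N}
    (hp : p.1 ∉ collisionSet N) : ContDiffAt ℝ 1 (field m α) p :=
  contDiffAt_snd.prodMk ((contDiffAt_acc m α hp).comp p contDiffAt_fst)

theorem mem_lifespan_coe {T t : ℝ} : t ∈ lifespan (T : EReal) ↔ t ∈ Ico 0 T := by
  simp [lifespan]

theorem IsSolution.hasDerivWithinAt {σ : EReal} {z : ℝ → Config N × Config N}
    (hz : IsSolution m α σ z) {t : ℝ} (ht : t ∈ lifespan σ) :
    HasDerivWithinAt z (field m α (z t)) (Ici 0) t :=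
  (hz.velocity t ht).prodMk (hz.acceleration t ht)

theorem isSolution_of_hasDerivWithinAt {σ : EReal} {z : ℝ → Config N × Config N} (hσ : 0 < σ)
    (hc : ∀ t ∈ lifespan σ, (z t).1 ∉ collisionSet N)
    (hz : ∀ t ∈ lifespan σ, HasDerivWithinAt z (field m α (z t)) (Ici 0) t) :
    IsSolution m α σ z where
  pos := hσ
  noCollision := hc
  velocity t ht :=
    (ContinuousLinearMap.fst ℝ (Config N) (Config N)).hasFDerivAt.comp_hasDerivWithinAt t (hz t ht)
  acceleration t ht :=
    (ContinuousLinearMap.snd ℝ (Config N) (Config N)).hasFDerivAt.comp_hasDerivWithinAt t (hz t ht)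

theorem lifespan_subset_Ici (σ : EReal) : lifespan σ ⊆ Ici 0 := fun _ h => h.1

theorem ordConnected_lifespan (σ : EReal) : (lifespan σ).OrdConnected :=
  ⟨fun _ ha _ hb _ ht => ⟨ha.1.trans ht.1, (EReal.coe_le_coe_iff.2 ht.2).trans_lt hb.2⟩⟩

theorem zero_mem_lifespan {σ : EReal} (hσ : 0 < σ) : (0 : ℝ) ∈ lifespan σ :=
  ⟨le_rfl, by simpa using hσ⟩

theorem constant_of_hasDerivWithinAt_zero {E : Type*} [NormedAddCommGroup E] [NormedSpace ℝ E]
    {f : ℝ → E} {σ : EReal} (h : ∀ t ∈ lifespan σ, HasDerivWithinAt f 0 (Ici 0) t) {s t : ℝ}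
    (hs : s ∈ lifespan σ) (ht : t ∈ lifespan σ) : f s = f t := by
  have hconv : Convex ℝ (lifespan σ) := (ordConnected_lifespan σ).convex
  have := hconv.norm_image_sub_le_of_norm_hasDerivWithin_le (C := 0)
    (fun u hu => (h u hu).mono (lifespan_subset_Ici σ)) (fun u _ => by simp) ht hs
  rw [zero_mul] at this
  exact sub_eq_zero.1 (norm_le_zero_iff.1 this)

theorem IsSolution.energy_eq {σ : EReal} {z : ℝ → Config N × Config N}
    (hz : IsSolution m α σ z) (hm : ∀ i, 0 < m i) (hα : 0 < α) {s t : ℝ}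
    (hs : s ∈ lifespan σ) (ht : t ∈ lifespan σ) :
    energy m α (z s).1 (z s).2 = energy m α (z t).1 (z t).2 :=
  constant_of_hasDerivWithinAt_zero (f := fun t => energy m α (z t).1 (z t).2)
    (fun u hu => hasDerivWithinAt_energy (v := fun t => (z t).2) hm hα (hz.velocity u hu)
      (hz.acceleration u hu) (hz.noCollision u hu)) hs ht

theorem IsSolution.angularMomentum_eq {σ : EReal} {z : ℝ → Config N × Config N}
    (hz : IsSolution m α σ z) (hm : ∀ i, 0 < m i) {s t : ℝ}
    (hs : s ∈ lifespan σ) (ht : t ∈ lifespan σ) :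
    angularMomentum m (z s).1 (z s).2 = angularMomentum m (z t).1 (z t).2 :=
  constant_of_hasDerivWithinAt_zero (f := fun t => angularMomentum m (z t).1 (z t).2)
    (fun u hu => hasDerivWithinAt_angularMomentum (v := fun t => (z t).2) hm (hz.velocity u hu)
      (hz.acceleration u hu)) hs ht

/-- A bound for the velocity in terms of the energy and a lower bound of the potential. -/
theorem norm_velocity_le (hm : ∀ i, 0 < m i) {x v : Config N} {C : ℝ}
    (h : energy m α x v - potential m α x ≤ C) : ‖v‖ ≤ ∑ i, Real.sqrt (2 * C / m i) := by
  refine (pi_norm_le_iff_of_nonneg (Finset.sum_nonneg fun i _ => Real.sqrt_nonneg _)).2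
    fun i => ?_
  refine le_trans ?_ (Finset.single_le_sum (f := fun i => Real.sqrt (2 * C / m i))
    (fun i _ => Real.sqrt_nonneg _) (Finset.mem_univ i))
  refine Real.le_sqrt_of_sq_le ?_
  rw [le_div_iff₀ (hm i)]
  have h1 := term_le_inertia hm v i
  unfold energy at h
  unfold inertia at h1
  linarith

/-- Continuing a solution that has a limit in phase space by a solution starting at the limit. -/
theorem exists_continuation {E : Type*} [NormedAddCommGroup E] [NormedSpace ℝ E] {f : E → E}
    {z y : ℝ → E} {T ε : ℝ} (hT : 0 < T) (hε : 0 < ε)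
    (hz : ∀ t ∈ Ico 0 T, HasDerivWithinAt z (f (z t)) (Ici 0) t)
    (hlim : Tendsto z (𝓝[<] T) (𝓝 (y T))) (hf : ContinuousAt f (y T))
    (hy : ∀ t ∈ Ioo (T - ε) (T + ε), HasDerivAt y (f (y t)) t) :
    ∃ w : ℝ → E, (∀ t < T, w t = z t) ∧ (∀ t, T ≤ t → w t = y t) ∧
      ∀ t ∈ Ico 0 (T + ε), HasDerivWithinAt w (f (w t)) (Ici 0) t := by
  classical
  set w : ℝ → E := fun t => if t < T then z t else y t with hw
  have h1 : ∀ t < T, w t = z t := fun t ht => if_pos ht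
  have h2 : ∀ t, T ≤ t → w t = y t := fun t ht => if_neg (not_lt.2 ht)
  refine ⟨w, h1, h2, fun t ht => ?_⟩
  have hlt : ∀ t ∈ Ico 0 T, HasDerivWithinAt w (f (w t)) (Ici 0) t := by
    intro t ht
    rw [h1 t ht.2]
    refine (hz t ht).congr_of_eventuallyEq ?_ (h1 t ht.2)
    filter_upwards [nhdsWithin_le_nhds (Iio_mem_nhds ht.2)] with s hs using h1 s hs
  rcases lt_trichotomy t T with h | rfl | h
  · exact hlt t ⟨ht.1, h⟩
  · rw [h2 t le_rfl]
    have hR : HasDerivWithinAt w (f (y t)) (Ici t) t :=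
      ((hy t ⟨by linarith, by linarith⟩).hasDerivWithinAt).congr (fun s hs => h2 s hs)
        (h2 t le_rfl)
    have hd : ∀ s ∈ Ioo 0 t, HasDerivAt w (f (z s)) s := fun s hs => by
      have := (hlt s ⟨hs.1.le, hs.2⟩).hasDerivAt (Ici_mem_nhds hs.1)
      rwa [h1 s hs.2] at this
    have hI : Ioo 0 t ∈ 𝓝[<] t := Ioo_mem_nhdsLT hT
    have hL : HasDerivWithinAt w (f (y t)) (Iic t) t := by
      refine hasDerivWithinAt_Iic_of_tendsto_deriv (s := Ioo 0 t)
        (fun s hs => (hd s hs).differentiableAt.differentiableWithinAt) ?_ hI ?_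
      · unfold ContinuousWithinAt
        rw [h2 t le_rfl]
        refine (hlim.congr' ?_).mono_left (nhdsWithin_mono t (fun s hs => hs.2))
        filter_upwards [self_mem_nhdsWithin] with s hs using (h1 s hs).symm
      · refine (hf.tendsto.comp hlim).congr' ?_
        filter_upwards [hI] with s hs using ((hd s hs).deriv).symm
    have hU := hL.union hR
    rw [Iic_union_Ici] at hU
    exact hU.mono (subset_univ _)
  · rw [h2 t h.le]
    refine ((hy t ⟨by linarith, ht.2⟩).hasDerivWithinAt).congr_of_eventuallyEq ?_ (h2 t h.le)
    filter_upwards [nhdsWithin_le_nhds (Ioi_mem_nhds h)] with s hs using h2 s (le_of_lt hs)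

/-- A maximal solution cannot have a limit outside the collision set. -/
theorem IsMaximalSolution.not_tendsto {T : ℝ} {z : ℝ → Config N × Config N}
    (hz : IsMaximalSolution m α (T : EReal) z) {q : Config N × Config N}
    (hq : q.1 ∉ collisionSet N) : ¬ Tendsto z (𝓝[<] T) (𝓝 q) := by
  intro hlim
  have hT : 0 < T := by exact_mod_cast hz.isSolution.pos
  have hcd := contDiffAt_field m α hq
  obtain ⟨y, hyT, ε, hε, hy⟩ :=
    hcd.exists_forall_mem_closedBall_exists_eq_forall_mem_Ioo_hasDerivAt₀ T
  have hycont : ContinuousAt (fun t => (y t).1) T :=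
    ((hy T ⟨by linarith, by linarith⟩).continuousAt).fst
  have hopen : ∀ᶠ t in 𝓝 T, (y t).1 ∉ collisionSet N :=
    hycont.eventually_mem
      ((isClosed_collisionSet N).isOpen_compl.mem_nhds (by simpa [hyT] using hq))
  obtain ⟨δ, hδ, hball⟩ := Metric.eventually_nhds_iff.1 hopen
  have hε' : 0 < min ε δ := lt_min hε hδ
  obtain ⟨w, h1, h2, h3⟩ := exists_continuation (f := field m α) hT hε'
    (fun t ht => hz.isSolution.hasDerivWithinAt (mem_lifespan_coe.2 ht))
    (by rwa [hyT]) (by rw [hyT]; exact hcd.continuousAt)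
    (fun t ht => hy t ⟨by linarith [ht.1, min_le_left ε δ], by linarith [ht.2, min_le_left ε δ]⟩)
  have hsol : IsSolution m α ((T + min ε δ : ℝ) : EReal) w := by
    refine isSolution_of_hasDerivWithinAt (by exact_mod_cast (by linarith : 0 < T + min ε δ))
      (fun t ht => ?_) (fun t ht => h3 t (mem_lifespan_coe.1 ht))
    have ht' := mem_lifespan_coe.1 ht
    rcases lt_or_ge t T with h | h
    · rw [h1 t h]
      exact hz.isSolution.noCollision t (mem_lifespan_coe.2 ⟨ht'.1, h⟩)
    · rw [h2 t h]
      refine hball ?_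
      rw [Real.dist_eq, abs_of_nonneg (by linarith)]
      linarith [ht'.2, min_le_right ε δ]
  have := hz.maximal _ w hsol (fun t ht => h1 t (mem_lifespan_coe.1 ht).2)
  have h4 : T + min ε δ ≤ T := by exact_mod_cast this
  linarith

/-- At a finite maximal time every limit point of the configuration is a collision: near a
collision-free limit point the speed is bounded by the energy, so the solution would converge in
phase space. -/
theorem IsMaximalSolution.mem_collisionSet_of_mapClusterPt (hm : ∀ i, 0 < m i) (hα : 0 < α)
    {T : ℝ} {z : ℝ → Config N × Config N} (hz : IsMaximalSolution m α (T : EReal) z)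
    {p : Config N} (hp : MapClusterPt p (𝓝[<] T) (fun t => (z t).1)) : p ∈ collisionSet N := by
  by_contra hpc
  have hsol := hz.isSolution
  have hT : 0 < T := by exact_mod_cast hsol.pos
  have h0 : (0 : ℝ) ∈ lifespan (T : EReal) := zero_mem_lifespan hsol.pos
  obtain ⟨r, hr, hball⟩ := Metric.nhds_basis_closedBall.mem_iff.1
    ((isClosed_collisionSet N).isOpen_compl.mem_nhds hpc)
  have hcomp : IsCompact (Metric.closedBall p r) := isCompact_closedBall p r
  obtain ⟨C, hC⟩ := hcomp.exists_bound_of_continuousOn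
    (fun x hx => (continuousAt_potential m α (hball hx)).continuousWithinAt)
  obtain ⟨B, hB⟩ := hcomp.exists_bound_of_continuousOn
    (fun x hx => (contDiffAt_acc m α (hball hx)).continuousAt.continuousWithinAt)
  set e := energy m α (z 0).1 (z 0).2 with he
  set V := ∑ i, Real.sqrt (2 * (e + C) / m i) with hV
  have hV0 : 0 ≤ V := Finset.sum_nonneg fun i _ => Real.sqrt_nonneg _
  have hspeed : ∀ t ∈ Ico 0 T, (z t).1 ∈ Metric.closedBall p r → ‖(z t).2‖ ≤ V := by
    intro t ht hx
    refine norm_velocity_le (α := α) (x := (z t).1) hm ?_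
    rw [← hsol.energy_eq hm hα h0 (mem_lifespan_coe.2 ht), ← he]
    have := (abs_le.1 (hC _ hx)).1
    linarith
  have hev : ∀ᶠ t in 𝓝[<] T, t ∈ Ioo (max 0 (T - r / (2 * (V + 1)))) T :=
    Ioo_mem_nhdsLT (max_lt hT (by linarith [div_pos hr (by positivity : 0 < 2 * (V + 1))]))
  obtain ⟨a, hax, haI⟩ := ((hp.frequently (Metric.ball_mem_nhds p (half_pos hr))).and_eventually
    hev).exists
  have ha0 : 0 ≤ a := (le_max_left _ _).trans haI.1.le
  have haT : T - a < r / (2 * (V + 1)) := by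
    have := (le_max_right 0 (T - r / (2 * (V + 1)))).trans_lt haI.1
    linarith
  have hsub : Ico a T ⊆ Ico 0 T := Ico_subset_Ico_left ha0
  have hd : ∀ t ∈ Ico a T, HasDerivWithinAt z (field m α (z t)) (Ico a T) t := fun t ht =>
    (hsol.hasDerivWithinAt (mem_lifespan_coe.2 (hsub ht))).mono fun s hs => (hsub hs).1
  have hd1 : ∀ t ∈ Ico a T, HasDerivWithinAt (fun t => (z t).1) (z t).2 (Ico a T) t := fun t ht =>
    (hsol.velocity t (mem_lifespan_coe.2 (hsub ht))).mono fun s hs => (hsub hs).1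
  have hstay : ∀ t ∈ Ico a T, (z t).1 ∈ Metric.closedBall p r := by
    intro b hb
    by_contra hbr
    have hbr' : r < dist (z b).1 p := not_le.1 hbr
    have hcont : ContinuousOn (fun t => dist (z t).1 p) (Icc a b) := fun t ht =>
      ((hd1 t ⟨ht.1, ht.2.trans_lt hb.2⟩).continuousWithinAt.mono
        (fun s hs => ⟨hs.1, hs.2.trans_lt hb.2⟩)).dist continuousWithinAt_const
    obtain ⟨c, hc, hcr, hlt⟩ := exists_first_hit hb.1 hcont
      (lt_trans (Metric.mem_ball.1 hax) (half_lt_self hr)) hbr'.le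
    have hmv := (convex_Icc a c).norm_image_sub_le_of_norm_hasDerivWithin_le (C := V)
      (f := fun t => (z t).1) (f' := fun t => (z t).2)
      (fun t ht => (hd1 t ⟨ht.1, (ht.2.trans hc.2).trans_lt hb.2⟩).mono
        (fun s hs => ⟨hs.1, (hs.2.trans hc.2).trans_lt hb.2⟩))
      (fun t ht => hspeed t (hsub ⟨ht.1, (ht.2.trans hc.2).trans_lt hb.2⟩) (by
        rcases ht.2.eq_or_lt with h | h
        · rw [h]; exact hcr.le
        · exact (hlt t ⟨ht.1, h⟩).le)) (left_mem_Icc.2 hc.1.le) (right_mem_Icc.2 hc.1.le)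
    rw [← dist_eq_norm, Real.norm_of_nonneg (by linarith [hc.1])] at hmv
    have h1 : V * (c - a) ≤ r / 2 := by
      have h2 : c - a ≤ r / (2 * (V + 1)) := by linarith [hc.2, hb.2]
      calc V * (c - a) ≤ (V + 1) * (r / (2 * (V + 1))) :=
            mul_le_mul (by linarith) h2 (by linarith [hc.1]) (by linarith)
        _ = r / 2 := by field_simp
    have h3 := dist_triangle (z c).1 (z a).1 p
    have h4 : dist (z a).1 p < r / 2 := hax
    linarith
  have hLip : LipschitzOnWith (Real.toNNReal (max V B)) z (Ico a T) := by
    refine (convex_Ico a T).lipschitzOnWith_of_nnnorm_hasDerivWithin_le hd fun t ht => ?_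
    rw [← NNReal.coe_le_coe, coe_nnnorm, Real.coe_toNNReal _ (hV0.trans (le_max_left _ _))]
    exact max_le_max (hspeed t (hsub ht) (hstay t ht)) (hB _ (hstay t ht))
  obtain ⟨g, hg, hzg⟩ := hLip.extend_finite_dimension
  have hIco : Ico a T ∈ 𝓝[<] T := Ico_mem_nhdsLT haI.2
  have hlim : Tendsto z (𝓝[<] T) (𝓝 (g T)) := by
    refine (hg.continuous.continuousAt.tendsto.mono_left nhdsWithin_le_nhds).congr' ?_
    filter_upwards [hIco] with t ht using (hzg ht).symm
  refine hz.not_tendsto (q := g T) (hball ?_) hlim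
  refine Metric.isClosed_closedBall.mem_of_tendsto
    ((continuous_fst.tendsto _).comp hlim) ?_
  filter_upwards [hIco] with t ht using hstay t ht

/-! ### Bounded concave moment of inertia forces a collision -/

/-- A curve with small acceleration passes near the midpoint of its end points at half time. -/
theorem norm_midpoint_sub_le {E : Type*} [NormedAddCommGroup E] [NormedSpace ℝ E]
    {h h' h'' : ℝ → E} {a b B : ℝ} (hab : a ≤ b)
    (h1 : ∀ t ∈ Icc a b, HasDerivWithinAt h (h' t) (Icc a b) t)
    (h2 : ∀ t ∈ Icc a b, HasDerivWithinAt h' (h'' t) (Icc a b) t)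
    (hB : ∀ t ∈ Icc a b, ‖h'' t‖ ≤ B) :
    ‖h ((a + b) / 2) - (1 / 2 : ℝ) • (h a + h b)‖ ≤ B * (b - a) ^ 2 := by
  set μ := (a + b) / 2 with hμ
  have hB0 : 0 ≤ B := (norm_nonneg _).trans (hB a (left_mem_Icc.2 hab))
  have hμI : μ ∈ Icc a b := ⟨by linarith, by linarith⟩
  have hg : ∀ t ∈ Icc a b,
      HasDerivWithinAt (fun s => h s - s • h' μ) (h' t - h' μ) (Icc a b) t := by
    intro t ht
    have := (h1 t ht).fun_sub ((hasDerivWithinAt_id t (Icc a b)).smul_const (h' μ))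
    simpa using this
  have hbd : ∀ t ∈ Icc a b, ‖h' t - h' μ‖ ≤ B * (b - a) := by
    intro t ht
    refine ((convex_Icc a b).norm_image_sub_le_of_norm_hasDerivWithin_le h2 hB hμI ht).trans ?_
    refine mul_le_mul_of_nonneg_left ?_ hB0
    rw [Real.norm_eq_abs, abs_le]
    exact ⟨by linarith [ht.1, hμI.2], by linarith [ht.2, hμI.1]⟩
  have hmv : ∀ t ∈ Icc a b, ‖(h t - t • h' μ) - (h μ - μ • h' μ)‖ ≤ B * (b - a) ^ 2 := by
    intro t ht
    refine ((convex_Icc a b).norm_image_sub_le_of_norm_hasDerivWithin_le hg hbd hμI ht).trans ?_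
    rw [sq, ← mul_assoc]
    refine mul_le_mul_of_nonneg_left ?_ (mul_nonneg hB0 (by linarith))
    rw [Real.norm_eq_abs, abs_le]
    exact ⟨by linarith [ht.1, hμI.2], by linarith [ht.2, hμI.1]⟩
  have e : h μ - (1 / 2 : ℝ) • (h a + h b) =
      -((1 / 2 : ℝ) • (((h a - a • h' μ) - (h μ - μ • h' μ)) +
        ((h b - b • h' μ) - (h μ - μ • h' μ)))) := by
    rw [hμ]; module
  rw [e, norm_neg, norm_smul]
  have h3 := norm_add_le ((h a - a • h' μ) - (h μ - μ • h' μ)) ((h b - b • h' μ) - (h μ - μ • h' μ))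
  have h4 := hmv a (left_mem_Icc.2 hab)
  have h5 := hmv b (right_mem_Icc.2 hab)
  rw [Real.norm_of_nonneg (by norm_num)]
  linarith

/-- The internal forces of a cluster cancel. -/
theorem sum_force_cluster (m : Fin N → ℝ) (α : ℝ) (x : Config N) (C : Finset (Fin N)) :
    ∑ j ∈ C, force m α x j =
      -∑ j ∈ C, ∑ k ∈ Cᶜ, (α * (m j * m k) / ‖x j - x k‖ ^ (α + 2)) • (x j - x k) := by
  set f : Fin N → Fin N → EuclideanSpace ℝ (Fin 3) := fun j k =>
    (α * (m j * m k) / ‖x j - x k‖ ^ (α + 2)) • (x j - x k) with hf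
  have hanti : ∀ j k, f j k = -f k j := fun j k => by
    simp only [hf]
    rw [norm_sub_rev, mul_comm (m j), ← smul_neg, neg_sub]
  have hzero : ∑ j ∈ C, ∑ k ∈ C, f j k = 0 := by
    have h2 : ∑ j ∈ C, ∑ k ∈ C, f j k = -∑ j ∈ C, ∑ k ∈ C, f j k := by
      conv_lhs => rw [Finset.sum_comm]
      rw [← Finset.sum_neg_distrib]
      refine Finset.sum_congr rfl fun i _ => ?_
      rw [← Finset.sum_neg_distrib]
      exact Finset.sum_congr rfl fun j _ => hanti j i
    have h3 : (2 : ℝ) • ∑ j ∈ C, ∑ k ∈ C, f j k = 0 := by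
      rw [two_smul]
      nth_rewrite 1 [h2]
      exact neg_add_cancel _
    exact (smul_eq_zero.1 h3).resolve_left two_ne_zero
  have h1 : ∀ j, force m α x j = -(∑ k ∈ C, f j k + ∑ k ∈ Cᶜ, f j k) := fun j => by
    rw [Finset.sum_add_sum_compl, force_eq]
  simp only [h1, Finset.sum_neg_distrib, Finset.sum_add_distrib, hzero, zero_add]
  rfl

open Classical in
/-- The cluster of body `i` at the configuration `p`: the bodies at the same place as `i`. -/
noncomputable def cluster (p : Config N) (i : Fin N) : Finset (Fin N) :=
  Finset.univ.filter fun j => p j = p i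

theorem mem_cluster {p : Config N} {i j : Fin N} : j ∈ cluster p i ↔ p j = p i := by
  simp [cluster]

/-- The average of `y` over the cluster of body `i` at `p`, weighted by the masses. -/
noncomputable def clusterMean (m : Fin N → ℝ) (p : Config N) (y : Config N) (i : Fin N) :
    EuclideanSpace ℝ (Fin 3) :=
  (∑ j ∈ cluster p i, m j)⁻¹ • ∑ j ∈ cluster p i, m j • y j

theorem cluster_mass_pos (hm : ∀ i, 0 < m i) (p : Config N) (i : Fin N) :
    0 < ∑ j ∈ cluster p i, m j :=
  Finset.sum_pos (fun j _ => hm j) ⟨i, mem_cluster.2 rfl⟩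

theorem norm_sub_clusterMean_le (hm : ∀ i, 0 < m i) {p y : Config N} {ε : ℝ} {i : Fin N}
    (h : ∀ j, p i = p j → ‖y i - y j‖ ≤ ε) : ‖y i - clusterMean m p y i‖ ≤ ε := by
  have hM := cluster_mass_pos hm p i
  have e : y i - clusterMean m p y i =
      (∑ j ∈ cluster p i, m j)⁻¹ • ∑ j ∈ cluster p i, m j • (y i - y j) := by
    unfold clusterMean
    simp only [smul_sub, Finset.sum_sub_distrib, ← Finset.sum_smul]
    rw [inv_smul_smul₀ hM.ne']
  rw [e, norm_smul, Real.norm_of_nonneg (inv_nonneg.2 hM.le), inv_mul_le_iff₀ hM, Finset.sum_mul]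
  refine (norm_sum_le _ _).trans (Finset.sum_le_sum fun j hj => ?_)
  rw [norm_smul, Real.norm_of_nonneg (hm j).le]
  exact mul_le_mul_of_nonneg_left (h j (mem_cluster.1 hj).symm) (hm j).le

theorem hasDerivWithinAt_clusterMean {y : ℝ → Config N} {y' : Config N} {S : Set ℝ} {t : ℝ}
    (p : Config N) (h : HasDerivWithinAt y y' S t) (i : Fin N) :
    HasDerivWithinAt (fun s => clusterMean m p (y s) i) (clusterMean m p y' i) S t :=
  (HasDerivWithinAt.fun_sum fun j _ =>
    (hasDerivWithinAt_coord h j).fun_const_smul (m j)).fun_const_smul _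

/-- The center of mass of a cluster has bounded acceleration as long as the bodies of different
clusters stay apart. -/
theorem exists_bound_clusterMean_acc (hm : ∀ i, 0 < m i) (α : ℝ) {p : Config N}
    {K : Set (Config N)} (hK : IsCompact K)
    (hsep : ∀ y ∈ K, ∀ i j, p i ≠ p j → y i ≠ y j) (i : Fin N) :
    ∃ B, ∀ y ∈ K, ‖clusterMean m p (acc m α y) i‖ ≤ B := by
  refine hK.exists_bound_of_continuousOn ?_
  have e : (fun y : Config N => clusterMean m p (acc m α y) i) = fun y =>
      (∑ j ∈ cluster p i, m j)⁻¹ • -∑ j ∈ cluster p i, ∑ k ∈ (cluster p i)ᶜ,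
        (α * (m j * m k) / ‖y j - y k‖ ^ (α + 2)) • (y j - y k) := by
    funext y
    rw [← sum_force_cluster]
    unfold clusterMean acc
    congr 1
    exact Finset.sum_congr rfl fun j _ => smul_inv_smul₀ (hm j).ne' _
  rw [e]
  intro y hy
  refine ContinuousAt.continuousWithinAt (Tendsto.const_smul (Tendsto.neg
    (tendsto_finsetSum _ fun j hj => tendsto_finsetSum _ fun k hk => ?_)) _)
  have hjk : y j ≠ y k := hsep y hy j k (by
    rw [mem_cluster.1 hj]
    exact fun h => (Finset.mem_compl.1 hk) (mem_cluster.2 h.symm))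
  have hp : 0 < ‖y j - y k‖ := norm_pos_iff.2 (sub_ne_zero.2 hjk)
  have h1 : ContinuousAt (fun y : Config N => y j - y k) y :=
    ((continuous_apply j).sub (continuous_apply k)).continuousAt
  exact (continuousAt_const.div (h1.norm.rpow_const (Or.inl hp.ne'))
    (Real.rpow_pos_of_pos hp _).ne').smul h1

/-- The parallelogram identity for the moment of inertia, with an error `w` at the midpoint. -/
theorem inertia_midpoint_le (hm : ∀ i, 0 < m i) {x y u : Config N} {R e : ℝ}
    (hx : ‖x‖ ≤ R) (hy : ‖y‖ ≤ R) (he : e ≤ 1)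
    (hu : ∀ i, ‖u i - (1 / 2 : ℝ) • (x i + y i)‖ ≤ e) :
    inertia m u ≤ (inertia m x + inertia m y) / 2 - inertia m (x - y) / 4 +
      (∑ i, m i) * ((2 * R + 1) * e) := by
  unfold inertia
  rw [← Finset.sum_add_distrib, Finset.sum_div, Finset.sum_div, ← Finset.sum_sub_distrib,
    Finset.sum_mul, ← Finset.sum_add_distrib]
  refine Finset.sum_le_sum fun i _ => ?_
  have h1 : ‖x i‖ ≤ R := (norm_le_pi_norm x i).trans hx
  have h2 : ‖y i‖ ≤ R := (norm_le_pi_norm y i).trans hy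
  have hpar := parallelogram_law_with_norm ℝ (x i) (y i)
  have h3 : ‖u i‖ ≤ ‖(1 / 2 : ℝ) • (x i + y i)‖ + e := by
    have := norm_add_le ((1 / 2 : ℝ) • (x i + y i)) (u i - (1 / 2 : ℝ) • (x i + y i))
    rw [add_sub_cancel] at this
    linarith [hu i]
  have he0 : 0 ≤ e := (norm_nonneg _).trans (hu i)
  rw [norm_smul, Real.norm_of_nonneg (by norm_num)] at h3
  have h4 : ‖x i + y i‖ ≤ 2 * R := (norm_add_le _ _).trans (by linarith)
  have h5 : ‖u i‖ ^ 2 ≤ (1 / 2 * ‖x i + y i‖ + e) ^ 2 := pow_le_pow_left₀ (norm_nonneg _) h3 2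
  have h6 : ‖u i‖ ^ 2 ≤ (‖x i‖ ^ 2 + ‖y i‖ ^ 2) / 2 - ‖x i - y i‖ ^ 2 / 4 + (2 * R + 1) * e := by
    have : e * e ≤ 1 * e := mul_le_mul_of_nonneg_right he he0
    nlinarith [mul_le_mul_of_nonneg_right h4 he0]
  have h7 := mul_le_mul_of_nonneg_left h6 (hm i).le
  rw [Pi.sub_apply]
  linarith

open Classical in
/-- The pairs of bodies that are at the same place. -/
noncomputable def collidingPairs (p : Config N) : Finset (Fin N × Fin N) :=
  Finset.univ.filter fun ij => p ij.1 = p ij.2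

theorem mem_collidingPairs {p : Config N} {ij : Fin N × Fin N} :
    ij ∈ collidingPairs p ↔ p ij.1 = p ij.2 := by
  simp [collidingPairs]

/-- Bodies in different clusters of `p` are apart in a neighbourhood of `p`. -/
theorem exists_separating_radius (p : Config N) :
    ∃ r > 0, ∀ y ∈ Metric.closedBall p r, ∀ i j, p i ≠ p j → y i ≠ y j := by
  have h : ∀ᶠ y in 𝓝 p, ∀ i j, p i ≠ p j → y i ≠ y j := by
    refine eventually_all.2 fun i => eventually_all.2 fun j => ?_
    by_cases hij : p i = p j
    · simp [hij]
    · have : {y : Config N | y i ≠ y j} ∈ 𝓝 p :=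
        (isOpen_ne_fun (continuous_apply i) (continuous_apply j)).mem_nhds hij
      filter_upwards [this] with y hy _ using hy
  obtain ⟨r, hr, hball⟩ := Metric.nhds_basis_closedBall.mem_iff.1 h
  exact ⟨r, hr, hball⟩

/-- Near a limit point with the least number of colliding pairs, the clusters of that limit point
collapse. -/
theorem eventually_cluster_small {x : ℝ → Config N} {T : ℝ} {p : Config N} {r ε : ℝ} (hε : 0 < ε)
    (hmin : ∀ q, MapClusterPt q (𝓝[<] T) x → (collidingPairs p).card ≤ (collidingPairs q).card)
    (hsep : ∀ y ∈ Metric.closedBall p r, ∀ i j, p i ≠ p j → y i ≠ y j) :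
    ∀ᶠ t in 𝓝[<] T, x t ∈ Metric.closedBall p r →
      ∀ i j, p i = p j → ‖x t i - x t j‖ ≤ ε := by
  suffices h : ∀ i j, p i = p j → ∀ᶠ t in 𝓝[<] T, x t ∈ Metric.closedBall p r →
      ‖x t i - x t j‖ ≤ ε by
    have h' : ∀ᶠ t in 𝓝[<] T, ∀ i j, x t ∈ Metric.closedBall p r → p i = p j →
        ‖x t i - x t j‖ ≤ ε := by
      refine eventually_all.2 fun i => eventually_all.2 fun j => ?_
      by_cases hij : p i = p j
      · filter_upwards [h i j hij] with t ht hx _ using ht hx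
      · exact Eventually.of_forall fun t _ h => absurd h hij
    filter_upwards [h'] with t ht hx i j hij using ht i j hx hij
  intro i j hij
  by_contra hcon
  have hfreq : ∃ᶠ t in 𝓝[<] T, x t ∈ Metric.closedBall p r ∩ {y | ε ≤ ‖y i - y j‖} := by
    refine (not_eventually.1 hcon).mono fun t ht => ?_
    rw [Classical.not_imp, not_le] at ht
    exact ⟨ht.1, ht.2.le⟩
  have hcl : IsClosed {y : Config N | ε ≤ ‖y i - y j‖} :=
    isClosed_le continuous_const
      (continuous_norm.comp ((continuous_apply i).sub (continuous_apply j)))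
  obtain ⟨q, ⟨hq1, hq2⟩, hq⟩ :=
    ((isCompact_closedBall p r).inter_right hcl).exists_mapClusterPt_of_frequently hfreq
  refine absurd (hmin q hq) (not_le.2 (Finset.card_lt_card ⟨fun kl hkl => ?_, fun hsub => ?_⟩))
  · rw [mem_collidingPairs] at hkl ⊢
    by_contra h
    exact hsep q hq1 _ _ h hkl
  · have h1 : (i, j) ∈ collidingPairs q := hsub (mem_collidingPairs.2 hij)
    rw [mem_collidingPairs] at h1
    have h2 : ε ≤ ‖q i - q j‖ := hq2
    rw [h1, sub_self, norm_zero] at h2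
    linarith

theorem norm_le_of_inertia_le (hm : ∀ i, 0 < m i) {x : Config N} {R : ℝ}
    (h : inertia m x ≤ R) : ‖x‖ ≤ ∑ i, Real.sqrt (R / m i) := by
  refine (pi_norm_le_iff_of_nonneg (Finset.sum_nonneg fun i _ => Real.sqrt_nonneg _)).2
    fun i => ?_
  refine le_trans ?_ (Finset.single_le_sum (f := fun i => Real.sqrt (R / m i))
    (fun i _ => Real.sqrt_nonneg _) (Finset.mem_univ i))
  refine Real.le_sqrt_of_sq_le ?_
  rw [le_div_iff₀ (hm i)]
  linarith [term_le_inertia hm x i]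

theorem exists_mapClusterPt_of_inertia_le (hm : ∀ i, 0 < m i) {x : ℝ → Config N} {T R : ℝ}
    (h : ∃ᶠ t in 𝓝[<] T, inertia m (x t) ≤ R) : ∃ p, MapClusterPt p (𝓝[<] T) x := by
  obtain ⟨p, -, hp⟩ := (isCompact_closedBall (0 : Config N)
    (∑ i, Real.sqrt (R / m i))).exists_mapClusterPt_of_frequently (h.mono fun t ht => by
      simpa using norm_le_of_inertia_le hm ht)
  exact ⟨p, hp⟩

/-- A bounded configuration whose moment of inertia is concave converges at the end of its
lifespan. If it kept leaving a neighbourhood of a limit point with the least number of colliding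
pairs, it would travel a fixed distance in a vanishing time along an almost straight path, so that
the moment of inertia would be too small at the midpoint. -/
theorem exists_tendsto_of_concaveOn (hm : ∀ i, 0 < m i) {T t₀ R : ℝ}
    {x v : ℝ → Config N} (ht₀ : t₀ < T)
    (hx : ∀ t ∈ Ico t₀ T, HasDerivWithinAt x (v t) (Ico t₀ T) t)
    (hv : ∀ t ∈ Ico t₀ T, HasDerivWithinAt v (acc m α (x t)) (Ico t₀ T) t)
    (hI : ∀ t ∈ Ico t₀ T, inertia m (x t) ≤ R)
    (hconc : ConcaveOn ℝ (Ico t₀ T) fun t => inertia m (x t)) :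
    ∃ p, MapClusterPt p (𝓝[<] T) x ∧ Tendsto x (𝓝[<] T) (𝓝 p) := by
  have hev : ∀ᶠ t in 𝓝[<] T, t ∈ Ico t₀ T := Ico_mem_nhdsLT ht₀
  have hΩ : {q | MapClusterPt q (𝓝[<] T) x}.Nonempty :=
    exists_mapClusterPt_of_inertia_le hm (hev.mono hI).frequently
  obtain ⟨p, hp, hmin'⟩ :=
    (measure fun q : Config N => (collidingPairs q).card).wf.has_min _ hΩ
  have hmin : ∀ q, MapClusterPt q (𝓝[<] T) x →
      (collidingPairs p).card ≤ (collidingPairs q).card := fun q hq => not_lt.1 (hmin' q hq)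
  refine ⟨p, hp, ?_⟩
  obtain ⟨r, hr, hsep⟩ := exists_separating_radius p
  choose B' hB' using exists_bound_clusterMean_acc hm α (isCompact_closedBall p r) hsep
  set B := ∑ i, |B' i| with hBdef
  have hB : ∀ i, ∀ y ∈ Metric.closedBall p r, ‖clusterMean m p (acc m α y) i‖ ≤ B :=
    fun i y hy => ((hB' i y hy).trans (le_abs_self _)).trans
      (Finset.single_le_sum (f := fun i => |B' i|) (fun i _ => abs_nonneg _) (Finset.mem_univ i))
  have hB0 : 0 ≤ B := Finset.sum_nonneg fun i _ => abs_nonneg _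
  set R' := ∑ i, Real.sqrt (R / m i) with hR'
  have hR'0 : 0 ≤ R' := Finset.sum_nonneg fun i _ => Real.sqrt_nonneg _
  by_contra hnot
  rw [Metric.tendsto_nhds] at hnot
  push Not at hnot
  obtain ⟨ρ', hρ', hfar'⟩ := hnot
  set ρ := min ρ' r with hρdef
  have hρ : 0 < ρ := lt_min hρ' hr
  have hfar : ∃ᶠ t in 𝓝[<] T, ρ ≤ dist (x t) p :=
    hfar'.mono fun t ht => (min_le_left _ _).trans ht
  -- a lower bound for the masses
  obtain ⟨μ, hμm, hμ⟩ : ∃ μ : ℝ, (∀ i, μ < m i) ∧ 0 < μ :=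
    ((eventually_all.2 fun i => nhdsWithin_le_nhds (Iio_mem_nhds (hm i))).and
      (self_mem_nhdsWithin : Ioi (0 : ℝ) ∈ 𝓝[>] 0)).exists
  -- `e` is the admissible distance between the midpoint of the path and that of its ends
  obtain ⟨e, ⟨he1, he2⟩, he⟩ : ∃ e : ℝ, (e < 1 ∧
      (∑ i, m i) * ((2 * R' + 1) * e) < μ * (ρ / 2) ^ 2 / 4) ∧ 0 < e := by
    have hc : Tendsto (fun e : ℝ => (∑ i, m i) * ((2 * R' + 1) * e)) (𝓝[>] 0) (𝓝 0) := by
      have : Continuous fun e : ℝ => (∑ i, m i) * ((2 * R' + 1) * e) := by fun_prop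
      simpa using (this.tendsto 0).mono_left nhdsWithin_le_nhds
    have h1 : ∀ᶠ e : ℝ in 𝓝[>] 0, e < 1 := nhdsWithin_le_nhds (Iio_mem_nhds one_pos)
    exact ((h1.and (hc.eventually_lt_const (by positivity))).and self_mem_nhdsWithin).exists
  have htime : ∀ᶠ t in 𝓝[<] T, B * (T - t) ^ 2 < e / 2 := by
    have hc : Tendsto (fun t : ℝ => B * (T - t) ^ 2) (𝓝[<] T) (𝓝 0) := by
      have : Continuous fun t : ℝ => B * (T - t) ^ 2 := by fun_prop
      simpa using (this.tendsto T).mono_left nhdsWithin_le_nhds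
    exact hc.eventually_lt_const (half_pos he)
  obtain ⟨l, hl, hlT⟩ := mem_nhdsLT_iff_exists_Ioo_subset.1
    ((hev.and htime).and (eventually_cluster_small (ε := e / 4) (by positivity) hmin hsep))
  obtain ⟨a, hap, haI⟩ := ((hp.frequently (Metric.ball_mem_nhds p (half_pos hρ))).and_eventually
    (Ioo_mem_nhdsLT hl)).exists
  obtain ⟨b, hbp, hbI⟩ := (hfar.and_eventually (Ioo_mem_nhdsLT haI.2)).exists
  have hin : ∀ t ∈ Icc a b, t ∈ Ioo l T := fun t ht =>
    ⟨haI.1.trans_le ht.1, ht.2.trans_lt hbI.2⟩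
  have hsub : Icc a b ⊆ Ico t₀ T := fun t ht => (hlT (hin t ht)).1.1
  have hcont : ContinuousOn (fun t => dist (x t) p) (Icc a b) := fun t ht =>
    (((hx t (hsub ht)).continuousWithinAt).mono hsub).dist continuousWithinAt_const
  obtain ⟨c, hc, hcρ, hlt⟩ := exists_first_hit hbI.1.le hcont
    (lt_trans (Metric.mem_ball.1 hap) (half_lt_self hρ)) hbp
  have hac : Icc a c ⊆ Icc a b := Icc_subset_Icc_right hc.2
  have hball : ∀ t ∈ Icc a c, x t ∈ Metric.closedBall p r := by
    intro t ht
    have : dist (x t) p ≤ ρ := by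
      rcases ht.2.eq_or_lt with h | h
      · rw [h]; exact hcρ.le
      · exact (hlt t ⟨ht.1, h⟩).le
    exact this.trans (min_le_right _ _)
  have haM : a ∈ Icc a c := left_mem_Icc.2 hc.1.le
  have hcM : c ∈ Icc a c := right_mem_Icc.2 hc.1.le
  have hmM : (a + c) / 2 ∈ Icc a c := ⟨by linarith [hc.1], by linarith [hc.1]⟩
  have hclose : ∀ t ∈ Icc a c, ∀ i, ‖x t i - clusterMean m p (x t) i‖ ≤ e / 4 := fun t ht i =>
    norm_sub_clusterMean_le hm fun j hij => (hlT (hin t (hac ht))).2 (hball t ht) i j hij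
  have hmid : ∀ i, ‖x ((a + c) / 2) i - (1 / 2 : ℝ) • (x a i + x c i)‖ ≤ e := by
    intro i
    have h1 := norm_midpoint_sub_le (B := B) hc.1.le
      (fun t ht => hasDerivWithinAt_clusterMean (m := m) p
        ((hx t (hsub (hac ht))).mono (hac.trans hsub)) i)
      (fun t ht => hasDerivWithinAt_clusterMean (m := m) p
        ((hv t (hsub (hac ht))).mono (hac.trans hsub)) i)
      (fun t ht => hB i _ (hball t ht))
    have h2 : B * (c - a) ^ 2 ≤ e / 2 := by
      refine le_trans ?_ (hlT (hin a (hac haM))).1.2.le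
      refine mul_le_mul_of_nonneg_left ?_ hB0
      exact pow_le_pow_left₀ (by linarith [hc.1]) (by linarith [hc.2, hbI.2]) 2
    have ha := hclose a haM i
    have hc := hclose c hcM i
    have hm := hclose _ hmM i
    set A := clusterMean m p (x a) i
    set D := clusterMean m p (x c) i
    set M := clusterMean m p (x ((a + c) / 2)) i
    have e1 : x ((a + c) / 2) i - (1 / 2 : ℝ) • (x a i + x c i) =
        (x ((a + c) / 2) i - M) + (M - (1 / 2 : ℝ) • (A + D)) -
          (1 / 2 : ℝ) • ((x a i - A) + (x c i - D)) := by module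
    rw [e1]
    refine (norm_sub_le _ _).trans ?_
    rw [norm_smul, Real.norm_of_nonneg (by norm_num)]
    have h3 := norm_add_le (x ((a + c) / 2) i - M) (M - (1 / 2 : ℝ) • (A + D))
    have h4 := norm_add_le (x a i - A) (x c i - D)
    linarith
  have hsize : ∀ t ∈ Icc a c, ‖x t‖ ≤ R' := fun t ht =>
    norm_le_of_inertia_le hm (hI t (hsub (hac ht)))
  have hpar := inertia_midpoint_le hm (hsize a haM) (hsize c hcM) he1.le hmid
  have hcc := hconc.2 (hsub (hac haM)) (hsub (hac hcM)) (by norm_num : (0 : ℝ) ≤ 1 / 2)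
    (by norm_num : (0 : ℝ) ≤ 1 / 2) (by norm_num)
  simp only [smul_eq_mul] at hcc
  rw [show 1 / 2 * a + 1 / 2 * c = (a + c) / 2 by ring] at hcc
  have hdist : ρ / 2 ≤ ‖x a - x c‖ := by
    rw [← dist_eq_norm]
    have h1 := dist_triangle (x c) (x a) p
    have h3 := dist_comm (x a) (x c)
    have h2 : dist (x a) p < ρ / 2 := hap
    linarith
  obtain ⟨i, hi⟩ : ∃ i, ρ / 2 ≤ ‖(x a - x c) i‖ := by
    by_contra h
    push Not at h
    exact absurd hdist (not_le.2 ((pi_norm_lt_iff (half_pos hρ)).2 h))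
  have hlow : μ * (ρ / 2) ^ 2 ≤ inertia m (x a - x c) := by
    refine le_trans ?_ (term_le_inertia hm (x a - x c) i)
    exact mul_le_mul (hμm i).le (pow_le_pow_left₀ (half_pos hρ).le hi 2) (by positivity) (hm i).le
  linarith

/-- If the lifespan is finite and the moment of inertia is bounded and concave near its end, then
the solution experiences a collision. -/
theorem IsMaximalSolution.collisionSingularity (hm : ∀ i, 0 < m i) (hα : 0 < α) {T t₀ R : ℝ}
    {z : ℝ → Config N × Config N} (hz : IsMaximalSolution m α (T : EReal) z)
    (ht₀ : t₀ ∈ Ico 0 T) (hI : ∀ t ∈ Ico t₀ T, inertia m (z t).1 ≤ R)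
    (hconc : ConcaveOn ℝ (Ico t₀ T) fun t => inertia m (z t).1) :
    CollisionSingularity (T : EReal) z := by
  have hsub : Ico t₀ T ⊆ Ico 0 T := Ico_subset_Ico_left ht₀.1
  obtain ⟨p, hp, hlim⟩ := exists_tendsto_of_concaveOn (α := α) (x := fun t => (z t).1)
    (v := fun t => (z t).2) hm ht₀.2
    (fun t ht => (hz.isSolution.velocity t (mem_lifespan_coe.2 (hsub ht))).mono
      fun s hs => (hsub hs).1)
    (fun t ht => (hz.isSolution.acceleration t (mem_lifespan_coe.2 (hsub ht))).mono
      fun s hs => (hsub hs).1) hI hconc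
  exact ⟨T, rfl, p, hz.mem_collisionSet_of_mapClusterPt hm hα hp, hlim⟩

/-! ### Analyticity of solutions of quadratic differential equations -/

section Quadratic

variable {E : Type*} [NormedAddCommGroup E] [NormedSpace ℝ E]

/-- The `n`-th Taylor coefficient at `0` of the solution of `y' = Q(y, y)` with initial value
`y₀`, computed by comparing coefficients. -/
noncomputable def taylorCoeff (Q : E →L[ℝ] E →L[ℝ] E) (y₀ : E) : ℕ → E
  | 0 => y₀
  | n + 1 => ((n : ℝ) + 1)⁻¹ • ∑ k : Fin (n + 1),
      Q (taylorCoeff Q y₀ k) (taylorCoeff Q y₀ (n - k))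
decreasing_by
  · exact k.2
  · omega

variable (Q : E →L[ℝ] E →L[ℝ] E)

theorem taylorCoeff_zero (y₀ : E) : taylorCoeff Q y₀ 0 = y₀ := by
  rw [taylorCoeff]

theorem taylorCoeff_succ (y₀ : E) (n : ℕ) :
    taylorCoeff Q y₀ (n + 1) = ((n : ℝ) + 1)⁻¹ •
      ∑ k ∈ Finset.range (n + 1), Q (taylorCoeff Q y₀ k) (taylorCoeff Q y₀ (n - k)) := by
  rw [taylorCoeff, Finset.sum_range]

theorem smul_taylorCoeff_succ (y₀ : E) (n : ℕ) :
    ((n : ℝ) + 1) • taylorCoeff Q y₀ (n + 1) =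
      ∑ k ∈ Finset.range (n + 1), Q (taylorCoeff Q y₀ k) (taylorCoeff Q y₀ (n - k)) := by
  rw [taylorCoeff_succ, smul_inv_smul₀ (by positivity)]

theorem norm_taylorCoeff_le {y₀ : E} {M : ℝ} (hM : ‖y₀‖ ≤ M) (n : ℕ) :
    ‖taylorCoeff Q y₀ n‖ ≤ M ^ (n + 1) * ‖Q‖ ^ n := by
  have hM0 : 0 ≤ M := (norm_nonneg _).trans hM
  induction n using Nat.strong_induction_on with
  | _ n ih =>
    cases n with
    | zero => simpa [taylorCoeff_zero] using hM
    | succ n =>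
      rw [taylorCoeff_succ, norm_smul, norm_inv, Real.norm_of_nonneg (by positivity),
        inv_mul_le_iff₀ (by positivity)]
      refine (norm_sum_le_of_le (n := fun _ => M ^ (n + 1 + 1) * ‖Q‖ ^ (n + 1)) _
        fun k hk => ?_).trans ?_
      · have hk' : k ≤ n := Nat.lt_succ_iff.1 (Finset.mem_range.1 hk)
        calc ‖Q (taylorCoeff Q y₀ k) (taylorCoeff Q y₀ (n - k))‖
            ≤ ‖Q‖ * ‖taylorCoeff Q y₀ k‖ * ‖taylorCoeff Q y₀ (n - k)‖ := Q.le_opNorm₂ _ _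
          _ ≤ ‖Q‖ * (M ^ (k + 1) * ‖Q‖ ^ k) * (M ^ (n - k + 1) * ‖Q‖ ^ (n - k)) := by
              gcongr
              · exact ih k (by omega)
              · exact ih (n - k) (by omega)
          _ = M ^ ((k + 1) + (n - k + 1)) * ‖Q‖ ^ (k + (n - k) + 1) := by
              generalize n - k = j
              ring
          _ = _ := by
              rw [show k + 1 + (n - k + 1) = n + 1 + 1 by omega, Nat.add_sub_cancel' hk']
      · simp

/-- Along a solution, the Taylor coefficients differentiate into each other. -/
theorem hasDerivAt_taylorCoeff {y : ℝ → E} {t : ℝ} (hy : HasDerivAt y (Q (y t) (y t)) t) (n : ℕ) :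
    HasDerivAt (fun s => taylorCoeff Q (y s) n)
      (((n : ℝ) + 1) • taylorCoeff Q (y t) (n + 1)) t := by
  induction n using Nat.strong_induction_on with
  | _ n ih =>
    cases n with
    | zero =>
      rw [smul_taylorCoeff_succ]
      simpa [taylorCoeff_zero] using hy
    | succ n =>
      set Y := taylorCoeff Q (y t) with hY
      have h : HasDerivAt (fun s => taylorCoeff Q (y s) (n + 1))
          (((n : ℝ) + 1)⁻¹ • ∑ k ∈ Finset.range (n + 1),
            (Q (Y k) ((((n - k : ℕ) : ℝ) + 1) • Y (n - k + 1)) +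
              Q (((k : ℝ) + 1) • Y (k + 1)) (Y (n - k)))) t := by
        simp only [taylorCoeff_succ]
        refine (HasDerivAt.fun_sum fun k hk => ?_).fun_const_smul _
        have hk' : k < n + 1 := Finset.mem_range.1 hk
        exact Q.hasDerivAt_of_bilinear (fun _ => ih k hk') (fun _ => ih (n - k) (by omega))
      refine h.congr_deriv ?_
      rw [smul_taylorCoeff_succ, inv_smul_eq_iff₀ (by positivity), ← hY]
      set a : ℕ → E := fun k => Q (Y k) (Y (n + 1 - k)) with ha
      have h1 : ∑ k ∈ Finset.range (n + 1), Q (Y k) ((((n - k : ℕ) : ℝ) + 1) • Y (n - k + 1)) =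
          ∑ k ∈ Finset.range (n + 2), ((n : ℝ) + 1 - k) • a k := by
        rw [Finset.sum_range_succ _ (n + 1)]
        have : ((n : ℝ) + 1 - ((n + 1 : ℕ) : ℝ)) • a (n + 1) = 0 := by push_cast; simp
        rw [this, add_zero]
        refine Finset.sum_congr rfl fun k hk => ?_
        have hk' : k ≤ n := Nat.lt_succ_iff.1 (Finset.mem_range.1 hk)
        rw [map_smul, Nat.cast_sub hk', show n - k + 1 = n + 1 - k by omega]
        congr 1
        ring
      have h2 : ∑ k ∈ Finset.range (n + 1), Q (((k : ℝ) + 1) • Y (k + 1)) (Y (n - k)) =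
          ∑ k ∈ Finset.range (n + 2), (k : ℝ) • a k := by
        rw [Finset.sum_range_succ' _ (n + 1)]
        simp only [Nat.cast_zero, zero_smul, add_zero]
        refine Finset.sum_congr rfl fun k _ => ?_
        rw [map_smul, smul_apply]
        simp only [ha]
        rw [show n + 1 - (k + 1) = n - k by omega]
        push_cast
        rfl
      rw [Finset.sum_add_distrib, h1, h2, ← Finset.sum_add_distrib, Finset.smul_sum]
      refine Finset.sum_congr rfl fun k _ => ?_
      rw [← add_smul]
      congr 1
      ring

/-- The derivative of the Taylor polynomial with respect to its centre telescopes. -/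
theorem hasDerivAt_taylor_sum {y : ℝ → E} {s : ℝ} (hy : HasDerivAt y (Q (y s) (y s)) s) (t : ℝ)
    (n : ℕ) :
    HasDerivAt (fun s => ∑ k ∈ Finset.range (n + 1), (t - s) ^ k • taylorCoeff Q (y s) k)
      ((t - s) ^ n • ((n : ℝ) + 1) • taylorCoeff Q (y s) (n + 1)) s := by
  induction n with
  | zero => simpa using hasDerivAt_taylorCoeff Q hy 0
  | succ n ih =>
    simp only [Finset.sum_range_succ _ (n + 1)]
    have hp : HasDerivAt (fun s : ℝ => (t - s) ^ (n + 1)) (-(((n : ℝ) + 1) * (t - s) ^ n)) s := by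
      have := ((hasDerivAt_id s).const_sub t).fun_pow (n + 1)
      simpa using this
    refine (ih.fun_add (hp.fun_smul (hasDerivAt_taylorCoeff Q hy (n + 1)))).congr_deriv ?_
    module

/-- Solutions of a quadratic differential equation are analytic. -/
theorem analyticAt_of_quadratic [CompleteSpace E] {y : ℝ → E} {L : ℝ}
    (hy : ∀ᶠ t in 𝓝 L, HasDerivAt y (Q (y t) (y t)) t) : AnalyticAt ℝ y L := by
  set M := ‖y L‖ + 1 with hM
  have hM0 : 0 < M := by positivity
  have hbd : ∀ᶠ t in 𝓝 L, ‖y t‖ < M :=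
    hy.self_of_nhds.continuousAt.norm.eventually_lt_const (by simp [hM])
  obtain ⟨δ, hδ, hball⟩ := Metric.eventually_nhds_iff_ball.1 (hy.and hbd)
  set c := M * (‖Q‖ + 1) with hc
  have hc0 : 0 < c := by positivity
  set a : ℕ → E := taylorCoeff Q (y L) with ha
  have hLδ : L ∈ Metric.ball L δ := Metric.mem_ball_self hδ
  have hcoeff : ∀ t ∈ Metric.ball L δ, ∀ n, ‖taylorCoeff Q (y t) n‖ ≤ M * c ^ n := by
    intro t ht n
    refine (norm_taylorCoeff_le Q (hball t ht).2.le n).trans ?_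
    rw [hc, mul_pow, pow_succ', mul_assoc]
    gcongr
    linarith
  have hsum : ∀ h : ℝ, |h| < δ → |h| * c < 1 → HasSum (fun n => h ^ n • a n) (y (L + h)) := by
    intro h hh hhc
    have hcn : 0 ≤ |h| * c := by positivity
    have hsm : Summable fun n => h ^ n • a n := by
      refine Summable.of_norm_bounded
        ((summable_geometric_of_lt_one hcn hhc).mul_left M) fun n => ?_
      rw [norm_smul, norm_pow, Real.norm_eq_abs, mul_pow]
      calc |h| ^ n * ‖a n‖ ≤ |h| ^ n * (M * c ^ n) := by
            gcongr
            exact hcoeff L hLδ n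
        _ = _ := by ring
    rw [hsm.hasSum_iff_tendsto_nat, ← tendsto_add_atTop_iff_nat 1,
      tendsto_iff_norm_sub_tendsto_zero]
    have hlim : Tendsto (fun n : ℕ => M * (((n + 1 : ℕ) : ℝ) * (|h| * c) ^ (n + 1)))
        atTop (𝓝 0) := by
      have := (tendsto_self_mul_const_pow_of_lt_one hcn hhc).comp (tendsto_add_atTop_nat 1)
      simpa using this.const_mul M
    refine squeeze_zero (fun _ => norm_nonneg _) (fun n => ?_) hlim
    have hmem : L + h ∈ Metric.ball L δ := by simpa [Metric.mem_ball, Real.dist_eq] using hh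
    have hseg : segment ℝ L (L + h) ⊆ Metric.ball L δ :=
      (convex_ball L δ).segment_subset hLδ hmem
    have hdist : ∀ s ∈ segment ℝ L (L + h), |L + h - s| ≤ |h| := by
      rintro s hs
      obtain ⟨θ, hθ, rfl⟩ := (segment_eq_image' ℝ L (L + h)).subset hs
      simp only [smul_eq_mul, add_sub_cancel_left]
      rw [show L + h - (L + θ * h) = (1 - θ) * h by ring, abs_mul,
        abs_of_nonneg (by linarith [hθ.2])]
      exact mul_le_of_le_one_left (abs_nonneg _) (by linarith [hθ.1])
    have hmv := (convex_segment L (L + h)).norm_image_sub_le_of_norm_hasDerivWithin_le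
      (C := |h| ^ n * (((n : ℝ) + 1) * (M * c ^ (n + 1))))
      (fun s hs => (hasDerivAt_taylor_sum Q (hball s (hseg hs)).1 (L + h) n).hasDerivWithinAt)
      (fun s hs => by
        rw [norm_smul, norm_smul, norm_pow, Real.norm_eq_abs,
          Real.norm_of_nonneg (by positivity : (0 : ℝ) ≤ n + 1)]
        exact mul_le_mul (pow_le_pow_left₀ (abs_nonneg _) (hdist s hs) n)
          (mul_le_mul_of_nonneg_left (hcoeff s (hseg hs) (n + 1)) (by positivity))
          (by positivity) (by positivity)) (right_mem_segment ℝ L (L + h))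
      (left_mem_segment ℝ L (L + h))
    have hend : ∑ k ∈ Finset.range (n + 1), (L + h - (L + h)) ^ k • taylorCoeff Q (y (L + h)) k =
        y (L + h) := by
      rw [Finset.sum_range_succ']
      simp [taylorCoeff_zero]
    rw [hend] at hmv
    simp only [add_sub_cancel_left] at hmv
    refine hmv.trans (le_of_eq ?_)
    rw [norm_sub_rev, add_sub_cancel_left, Real.norm_eq_abs]
    clear_value c
    push_cast
    ring
  let P : FormalMultilinearSeries ℝ ℝ E :=
    fun n => ContinuousMultilinearMap.mkPiRing ℝ (Fin n) (a n)
  have hP : ∀ n, P.coeff n = a n := fun n => by simp [P, FormalMultilinearSeries.coeff]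
  refine ⟨P, hasFPowerSeriesAt_iff.2 ?_⟩
  have hev : ∀ᶠ h in 𝓝 (0 : ℝ), |h| < δ ∧ |h| * c < 1 := by
    have h1 : Tendsto (fun h : ℝ => |h|) (𝓝 0) (𝓝 0) := by
      simpa using (continuous_abs.tendsto (0 : ℝ))
    have h2 : Tendsto (fun h : ℝ => |h| * c) (𝓝 0) (𝓝 0) := by simpa using h1.mul_const c
    exact (h1.eventually_lt_const hδ).and (h2.eventually_lt_const one_pos)
  filter_upwards [hev] with h hh
  simpa only [hP] using hsum h hh.1 hh.2

end Quadratic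

/-! ### Analyticity of collision-free motions -/

/-- Vectors in three-space indexed by ordered pairs of bodies. -/
abbrev PairVectors (N : ℕ) : Type := Fin N → Fin N → EuclideanSpace ℝ (Fin 3)

/-- The variables `(1, x, v), (ψ, s, u), (φ, η, κ)` in which the `N`-body problem is quadratic. For
a pair of bodies with relative position `d` and relative velocity `e`, they are `ψ = |d|^{-α-2}`,
`s = |d|^{-2} ⟨d, e⟩`, `u = |d|^{-2}`, `φ = ψ d`, `η = |d|^{-2} d` and `κ = |d|^{-2} e`. -/
abbrev QuadState (N : ℕ) : Type :=
  (ℝ × Config N × Config N) ×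
    ((Fin N → Fin N → ℝ) × (Fin N → Fin N → ℝ) × (Fin N → Fin N → ℝ)) ×
    (PairVectors N × PairVectors N × PairVectors N)

/-- Instance search is very slow on products with many factors; this instance and the following two
settle the types that occur. -/
instance continuousSMul_pairVectors (N : ℕ) : ContinuousSMul ℝ
    (PairVectors N × PairVectors N × PairVectors N) :=
  @Prod.continuousSMul _ _ _ _ _ _ _ _ inferInstance
    (@Prod.continuousSMul _ _ _ _ _ _ _ _ inferInstance inferInstance)

instance continuousSMul_pairVariables (N : ℕ) : ContinuousSMul ℝ
    (((Fin N → Fin N → ℝ) × (Fin N → Fin N → ℝ) × (Fin N → Fin N → ℝ)) ×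
      (PairVectors N × PairVectors N × PairVectors N)) :=
  @Prod.continuousSMul _ _ _ _ _ _ _ _ inferInstance (continuousSMul_pairVectors N)

instance continuousSMul_quadState (N : ℕ) : ContinuousSMul ℝ (QuadState N) :=
  @Prod.continuousSMul _ _ _ _ _ _ _ _ inferInstance (continuousSMul_pairVariables N)

/-- The acceleration of body `i` in terms of the pair variables `φ`. -/
noncomputable def pairAcc (m : Fin N → ℝ) (α : ℝ) : PairVectors N →ₗ[ℝ] Config N where
  toFun φ i := -∑ j, (α * m j) • φ i j
  map_add' φ φ' := by
    funext i
    simp only [Pi.add_apply, smul_add, Finset.sum_add_distrib, neg_add]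
  map_smul' c φ := by
    funext i
    simp only [Pi.smul_apply, RingHom.id_apply, smul_neg, Finset.smul_sum, smul_comm c]

/-- The bilinear right-hand side of the `N`-body problem in the variables `QuadState`. -/
noncomputable def quadRhs (m : Fin N → ℝ) (α : ℝ) :
    QuadState N →ₗ[ℝ] QuadState N →ₗ[ℝ] QuadState N :=
  LinearMap.mk₂ ℝ
    (fun a b =>
      ((0, a.1.1 • b.1.2.2, a.1.1 • pairAcc m α b.2.2.1),
        (fun i j => -(α + 2) * (a.2.1.1 i j * b.2.1.2.1 i j),
        fun i j => -2 * (a.2.1.2.1 i j * b.2.1.2.1 i j) +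
          inner ℝ (a.2.2.2.2 i j) (b.1.2.2 i - b.1.2.2 j) +
          inner ℝ (a.2.2.2.1 i j) (pairAcc m α b.2.2.1 i - pairAcc m α b.2.2.1 j),
        fun i j => -2 * (a.2.1.2.2 i j * b.2.1.2.1 i j)),
        (fun i j => -(α + 2) • a.2.1.2.1 i j • b.2.2.1 i j +
          a.2.1.1 i j • (b.1.2.2 i - b.1.2.2 j),
        fun i j => (-2 : ℝ) • a.2.1.2.1 i j • b.2.2.2.1 i j +
          a.2.1.2.2 i j • (b.1.2.2 i - b.1.2.2 j),
        fun i j => (-2 : ℝ) • a.2.1.2.1 i j • b.2.2.2.2 i j +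
          a.2.1.2.2 i j • (pairAcc m α b.2.2.1 i - pairAcc m α b.2.2.1 j))))
    (fun a a' b => by
      simp only [Prod.fst_add, Prod.snd_add, Prod.mk_add_mk, Prod.mk.injEq]
      refine ⟨⟨by simp, by module, by module⟩, ⟨?_, ?_, ?_⟩, ?_, ?_, ?_⟩ <;> funext i j <;>
        simp only [Pi.add_apply, inner_add_left] <;> first | ring1 | module)
    (fun c a b => by
      simp only [Prod.smul_fst, Prod.smul_snd, Prod.smul_mk, Prod.mk.injEq]
      refine ⟨⟨by simp, by module, by module⟩, ⟨?_, ?_, ?_⟩, ?_, ?_, ?_⟩ <;> funext i j <;>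
        simp only [Pi.smul_apply, real_inner_smul_left, smul_eq_mul] <;> first | ring1 | module)
    (fun a b b' => by
      simp only [Prod.fst_add, Prod.snd_add, Prod.mk_add_mk, Prod.mk.injEq, map_add]
      refine ⟨⟨by simp, by module, by module⟩, ⟨?_, ?_, ?_⟩, ?_, ?_, ?_⟩ <;> funext i j <;>
        simp only [Pi.add_apply, inner_add_right, inner_sub_right] <;> first | ring1 | module)
    (fun c a b => by
      simp only [Prod.smul_fst, Prod.smul_snd, Prod.smul_mk, Prod.mk.injEq, map_smul]
      refine ⟨⟨by simp, by module, by module⟩, ⟨?_, ?_, ?_⟩, ?_, ?_, ?_⟩ <;> funext i j <;>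
        simp only [Pi.smul_apply, real_inner_smul_right, inner_sub_right, smul_eq_mul] <;>
        first | ring1 | module)

/-- The variables `QuadState` of a configuration `x` with velocity `v`. -/
noncomputable def quadState (α : ℝ) (x v : Config N) : QuadState N :=
  ((1, x, v),
    (fun i j => ‖x i - x j‖ ^ (-(α + 2)),
    fun i j => ‖x i - x j‖ ^ (-2 : ℝ) * inner ℝ (x i - x j) (v i - v j),
    fun i j => ‖x i - x j‖ ^ (-2 : ℝ)),
    (fun i j => ‖x i - x j‖ ^ (-(α + 2)) • (x i - x j),
    fun i j => ‖x i - x j‖ ^ (-2 : ℝ) • (x i - x j),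
    fun i j => ‖x i - x j‖ ^ (-2 : ℝ) • (v i - v j)))

theorem pairAcc_eq_acc (hm : ∀ i, 0 < m i) (α : ℝ) (x : Config N) :
    pairAcc m α (fun i j => ‖x i - x j‖ ^ (-(α + 2)) • (x i - x j)) = acc m α x := by
  funext i
  change -∑ j, (α * m j) • ‖x i - x j‖ ^ (-(α + 2)) • (x i - x j) = (m i)⁻¹ • force m α x i
  rw [force_eq, smul_neg, Finset.smul_sum]
  congr 1
  refine Finset.sum_congr rfl fun j _ => ?_
  rw [smul_smul, smul_smul, Real.rpow_neg (norm_nonneg _), div_eq_mul_inv]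
  congr 1
  have := (hm i).ne'
  field_simp

section Analyticity

variable {x v : ℝ → Config N} {t : ℝ}

/-- The derivative of a power of a mutual distance. For `i = j` the function is constant and the
formula gives `0`. -/
theorem hasDerivAt_dist_rpow (hx : HasDerivAt x (v t) t) (hc : x t ∉ collisionSet N) (β : ℝ)
    (i j : Fin N) :
    HasDerivAt (fun s => ‖x s i - x s j‖ ^ β)
      (β * (‖x t i - x t j‖ ^ β *
        (‖x t i - x t j‖ ^ (-2 : ℝ) * inner ℝ (x t i - x t j) (v t i - v t j)))) t := by
  rcases eq_or_ne i j with rfl | hij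
  · simpa using hasDerivAt_const t ((0 : ℝ) ^ β)
  · have hp := dist_pos_of_notMem hc hij
    have hd := ((hasDerivAt_pi.1 hx) i).fun_sub ((hasDerivAt_pi.1 hx) j)
    have h := (hasDerivWithinAt_norm_rpow hd.hasDerivWithinAt (S := univ)
      (norm_pos_iff.1 hp) β).hasDerivAt univ_mem
    refine h.congr_deriv ?_
    rw [sub_eq_add_neg β 2, Real.rpow_add hp]
    ring

theorem hasDerivAt_quadState (hm : ∀ i, 0 < m i) (hx : HasDerivAt x (v t) t)
    (hv : HasDerivAt v (acc m α (x t)) t) (hc : x t ∉ collisionSet N) :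
    HasDerivAt (fun s => quadState α (x s) (v s))
      (quadRhs m α (quadState α (x t) (v t)) (quadState α (x t) (v t))) t := by
  have hψ : ∀ i j, _ := hasDerivAt_dist_rpow hx hc (-(α + 2))
  have hu : ∀ i j, _ := hasDerivAt_dist_rpow hx hc (-2)
  have hd : ∀ i j, HasDerivAt (fun s => x s i - x s j) (v t i - v t j) t := fun i j =>
    ((hasDerivAt_pi.1 hx) i).fun_sub ((hasDerivAt_pi.1 hx) j)
  have he : ∀ i j, HasDerivAt (fun s => v s i - v s j) (acc m α (x t) i - acc m α (x t) j) t :=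
    fun i j => ((hasDerivAt_pi.1 hv) i).fun_sub ((hasDerivAt_pi.1 hv) j)
  have h1 := (hasDerivAt_const t (1 : ℝ)).prodMk (hx.prodMk hv)
  have h2 := (hasDerivAt_pi.2 fun i => hasDerivAt_pi.2 fun j => hψ i j).prodMk
    ((hasDerivAt_pi.2 fun i => hasDerivAt_pi.2 fun j =>
      (hu i j).fun_mul ((hd i j).inner ℝ (he i j))).prodMk
    (hasDerivAt_pi.2 fun i => hasDerivAt_pi.2 fun j => hu i j))
  have h3 := (hasDerivAt_pi.2 fun i => hasDerivAt_pi.2 fun j => (hψ i j).fun_smul (hd i j)).prodMk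
    ((hasDerivAt_pi.2 fun i => hasDerivAt_pi.2 fun j => (hu i j).fun_smul (hd i j)).prodMk
    (hasDerivAt_pi.2 fun i => hasDerivAt_pi.2 fun j => (hu i j).fun_smul (he i j)))
  refine (h1.prodMk (h2.prodMk h3)).congr_deriv ?_
  simp only [quadRhs, quadState, LinearMap.mk₂_apply, pairAcc_eq_acc hm, Prod.mk.injEq, one_smul,
    true_and, and_true]
  refine ⟨?_, ?_, ?_, ?_⟩ <;> funext i j
  · simp only [real_inner_smul_left]
    ring
  all_goals module

/-- Collision-free motions are analytic in time. -/
theorem analyticAt_of_eventually (hm : ∀ i, 0 < m i)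
    (hx : ∀ᶠ t in 𝓝 t, HasDerivAt x (v t) t) (hv : ∀ᶠ t in 𝓝 t, HasDerivAt v (acc m α (x t)) t)
    (hc : ∀ᶠ t in 𝓝 t, x t ∉ collisionSet N) : AnalyticAt ℝ x t := by
  have h : AnalyticAt ℝ (fun s => quadState α (x s) (v s)) t :=
    analyticAt_of_quadratic (quadRhs m α).toContinuousBilinearMap (by
      filter_upwards [hx, hv, hc] with s h1 h2 h3 using hasDerivAt_quadState hm h1 h2 h3)
  have h1 : (fun p : QuadState N => p.1.2.1) ∘ (fun s => quadState α (x s) (v s)) = x := rfl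
  rw [← h1]
  exact (analyticAt_fst.comp (analyticAt_snd.comp analyticAt_fst)).comp h

end Analyticity

theorem analyticAt_threshold (m : Fin N → ℝ) (α ω : ℝ) {y : Config N}
    (hy : y ∉ collisionSet N) : AnalyticAt ℝ (threshold m α ω) y := by
  refine ContDiffAt.analyticAt (𝕜 := ℝ) ?_
  unfold threshold inertia potential
  refine (contDiffAt_const.mul (ContDiffAt.sum fun i _ => contDiffAt_const.mul
    ((contDiff_apply ℝ _ i).contDiffAt.norm_sq ℝ))).add (contDiffAt_const.mul
      (ContDiffAt.neg (ContDiffAt.sum fun i _ => ContDiffAt.sum fun j hj => ?_)))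
  have hp := dist_pos_of_notMem hy (Finset.mem_Ioi.1 hj).ne
  have h1 : ContDiffAt ℝ ⊤ (fun y : Config N => y i - y j) y :=
    ((contDiff_apply ℝ _ i).sub (contDiff_apply ℝ _ j)).contDiffAt
  exact contDiffAt_const.div ((h1.norm ℝ (norm_pos_iff.1 hp)).rpow_const_of_ne hp.ne')
    (Real.rpow_pos_of_pos hp _).ne'

/-- An analytic function cannot change sign along an increasing sequence converging to a point
of its domain. -/
theorem not_alternating_of_analyticAt {g : ℝ → ℝ} {L : ℝ} (hg : AnalyticAt ℝ g L) {τ : ℕ → ℝ}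
    (hτ : StrictMono τ) (hlim : Tendsto τ atTop (𝓝 L)) (h0 : ∀ n, 0 ≤ g (τ (2 * n)))
    (h1 : ∀ n, g (τ (2 * n + 1)) < 0) : False := by
  have hlt : ∀ n, τ n < L := fun n =>
    (hτ (Nat.lt_succ_self n)).trans_le (hτ.monotone.ge_of_tendsto hlim _)
  have ht1 : Tendsto (fun n => τ (2 * n + 1)) atTop (𝓝[≠] L) := by
    refine tendsto_nhdsWithin_iff.2 ⟨hlim.comp ?_, Eventually.of_forall fun n => (hlt _).ne⟩
    exact tendsto_atTop_mono (fun n => by change n ≤ 2 * n + 1; omega) tendsto_id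
  obtain ⟨δ, hδ, hcont⟩ := Metric.eventually_nhds_iff_ball.1 hg.eventually_continuousAt
  have hnear : ∀ᶠ n in atTop, τ n ∈ Metric.ball L δ := hlim (Metric.ball_mem_nhds L hδ)
  obtain ⟨n₀, hn₀⟩ := eventually_atTop.1 hnear
  have hz : ∀ n, n₀ ≤ n → ∃ s ∈ Ico (τ (2 * n)) (τ (2 * n + 1)), g s = 0 := by
    intro n hn
    have hsub : Icc (τ (2 * n)) (τ (2 * n + 1)) ⊆ Metric.ball L δ := by
      rw [← segment_eq_Icc (hτ (Nat.lt_succ_self _)).le]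
      exact (convex_ball L δ).segment_subset (hn₀ _ (by omega)) (hn₀ _ (by omega))
    obtain ⟨s, hs, hs0⟩ := intermediate_value_Icc' (hτ (Nat.lt_succ_self (2 * n))).le
      (fun s hs => (hcont s (hsub hs)).continuousWithinAt) ⟨(h1 n).le, h0 n⟩
    refine ⟨s, ⟨hs.1, lt_of_le_of_ne hs.2 ?_⟩, hs0⟩
    rintro rfl
    exact (h1 n).ne hs0
  rcases hg.eventually_eq_zero_or_eventually_ne_zero with h | h
  · obtain ⟨n, hn⟩ := (ht1.eventually (nhdsWithin_le_nhds h)).exists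
    exact (h1 n).ne hn
  · choose! s hs hs0 using hz
    have hts : Tendsto s atTop (𝓝[≠] L) := by
      refine tendsto_nhdsWithin_iff.2 ⟨?_, ?_⟩
      · refine tendsto_of_tendsto_of_tendsto_of_le_of_le' (g := fun n => τ (2 * n))
          (h := fun n => τ (2 * n + 1)) (hlim.comp ?_) (tendsto_nhds_of_tendsto_nhdsWithin ht1)
          ?_ ?_
        · exact tendsto_atTop_mono (fun n => by change n ≤ 2 * n; omega) tendsto_id
        · filter_upwards [eventually_ge_atTop n₀] with n hn using (hs n hn).1
        · filter_upwards [eventually_ge_atTop n₀] with n hn using (hs n hn).2.le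
      · filter_upwards [eventually_ge_atTop n₀] with n hn using ((hs n hn).2.trans (hlt _)).ne
    obtain ⟨n, hn, hn'⟩ := ((hts.eventually h).and (eventually_ge_atTop n₀)).exists
    exact hn (hs0 n hn')

/-! ### The moment of inertia along a solution -/

variable {σ : EReal} {z : ℝ → Config N × Config N}

theorem exists_gt_mem_lifespan {t : ℝ} (ht : t ∈ lifespan σ) : ∃ t' ∈ lifespan σ, t < t' := by
  obtain ⟨t', h1, h2⟩ := EReal.lt_iff_exists_real_btwn.1 ht.2
  have h3 : t < t' := by exact_mod_cast h1
  exact ⟨t', ⟨ht.1.trans h3.le, h2⟩, h3⟩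

theorem exists_eq_coe_of_ne_top (hσ : 0 < σ) (h : σ ≠ ⊤) : ∃ T : ℝ, σ = (T : EReal) :=
  ⟨σ.toReal, (EReal.coe_toReal h (ne_bot_of_gt hσ)).symm⟩

theorem Icc_subset_lifespan {a b : ℝ} (ha : a ∈ lifespan σ) (hb : b ∈ lifespan σ) :
    Icc a b ⊆ lifespan σ := (ordConnected_lifespan σ).out ha hb

theorem le_add_mul_of_hasDerivWithinAt {f f' : ℝ → ℝ} {a b C : ℝ} (ha : 0 ≤ a) (hab : a ≤ b)
    (h : ∀ t ∈ Icc a b, HasDerivWithinAt f (f' t) (Ici 0) t) (hC : ∀ t ∈ Ico a b, f' t ≤ C) :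
    f b ≤ f a + C * (b - a) := by
  have hB : ∀ t, HasDerivAt (fun t => f a + C * (t - a)) C t := fun t => by
    simpa using (((hasDerivAt_id t).sub_const a).const_mul C).const_add (f a)
  exact image_le_of_deriv_right_le_deriv_boundary (f := f) (f' := f')
    (B := fun t => f a + C * (t - a)) (B' := fun _ => C)
    (fun t ht => (h t ht).continuousWithinAt.mono fun s hs => ha.trans hs.1)
    (fun t ht => (h t ⟨ht.1, ht.2.le⟩).mono fun s hs => (ha.trans ht.1).trans hs)
    (by simp) (fun t _ => (hB t).continuousAt.continuousWithinAt)
    (fun t _ => (hB t).hasDerivWithinAt) hC (right_mem_Icc.2 hab)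

theorem IsSolution.hasDerivWithinAt_inertia (hz : IsSolution m α σ z) {t : ℝ}
    (ht : t ∈ lifespan σ) :
    HasDerivWithinAt (fun s => inertia m (z s).1) (2 * virial m (z t).1 (z t).2) (Ici 0) t :=
  NBody.hasDerivWithinAt_inertia (v := fun t => (z t).2) (hz.velocity t ht)

theorem IsSolution.hasDerivWithinAt_virial (hz : IsSolution m α σ z) (hm : ∀ i, 0 < m i)
    (hα : 0 < α) {t : ℝ} (ht : t ∈ lifespan σ) :
    HasDerivWithinAt (fun s => virial m (z s).1 (z s).2)
      (2 * energy m α (z t).1 (z t).2 + (α - 2) * potential m α (z t).1) (Ici 0) t :=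
  NBody.hasDerivWithinAt_virial (v := fun t => (z t).2) hm hα (hz.velocity t ht)
    (hz.acceleration t ht)

theorem IsSolution.continuousWithinAt_threshold (hz : IsSolution m α σ z) {t : ℝ}
    (ht : t ∈ lifespan σ) :
    ContinuousWithinAt (fun s => threshold m α ω (z s).1) (Ici 0) t :=
  (analyticAt_threshold m α ω (hz.noCollision t ht)).continuousAt.comp_continuousWithinAt
    (f := fun s => (z s).1) (hz.velocity t ht).continuousWithinAt

/-- The set `𝒦` is invariant, because energy and angular momentum are conserved. -/
theorem IsSolution.mem_setK (hz : IsSolution m α σ z) (hm : ∀ i, 0 < m i) (hα : 0 < α) {s t : ℝ}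
    (hs : s ∈ lifespan σ) (ht : t ∈ lifespan σ) (h : z s ∈ setK m α ω) : z t ∈ setK m α ω := by
  refine ⟨hz.noCollision t ht, ?_, ?_⟩
  · rw [hz.energy_eq hm hα ht hs]
    exact h.2.1
  · rw [hz.angularMomentum_eq hm ht hs]
    exact h.2.2

/-- Where `K_ω ≤ 0`, the moment of inertia is uniformly concave. -/
theorem virial_deriv_le (hN : 2 ≤ N) (hm : ∀ i, 0 < m i) (hα : 2 < α) (hω : 0 < ω)
    {p : Config N × Config N} (hp : p.1 ∉ collisionSet N) (hK : threshold m α ω p.1 ≤ 0) :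
    2 * energy m α p.1 p.2 + (α - 2) * potential m α p.1 ≤
      -(2 * (excitedEnergy m α ω - energy m α p.1 p.2)) := by
  have := excitedEnergy_le_of_threshold_nonpos hN hm hα hω hp hK
  linarith

theorem IsSolution.exists_inertia_le (hN : 2 ≤ N) (hm : ∀ i, 0 < m i) (hα : 2 < α) {T : ℝ}
    (hz : IsSolution m α (T : EReal) z) : ∃ R, ∀ t ∈ Ico 0 T, inertia m (z t).1 ≤ R := by
  have hα0 : 0 < α := by linarith
  have h0 : (0 : ℝ) ∈ lifespan (T : EReal) := zero_mem_lifespan hz.pos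
  have hT : 0 < T := by exact_mod_cast hz.pos
  set e := energy m α (z 0).1 (z 0).2 with he
  set w₀ := virial m (z 0).1 (z 0).2 with hw₀
  set W := |w₀| + 2 * |e| * T with hW
  have hsub : ∀ t ∈ Ico 0 T, ∀ s ∈ Icc 0 t, s ∈ lifespan (T : EReal) := fun t ht s hs =>
    mem_lifespan_coe.2 ⟨hs.1, hs.2.trans_lt ht.2⟩
  have hw : ∀ t ∈ Ico 0 T, virial m (z t).1 (z t).2 ≤ W := by
    intro t ht
    have h := le_add_mul_of_hasDerivWithinAt (C := 2 * |e|) le_rfl ht.1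
      (fun s hs => hz.hasDerivWithinAt_virial hm hα0 (hsub t ht s hs)) (fun s hs => by
        have hs' := hsub t ht s ⟨hs.1, hs.2.le⟩
        rw [← hz.energy_eq hm hα0 h0 hs', ← he]
        have h1 := potential_neg (α := α) hN hm (hz.noCollision s hs')
        have h2 : (α - 2) * potential m α (z s).1 ≤ 0 :=
          mul_nonpos_of_nonneg_of_nonpos (by linarith) h1.le
        linarith [le_abs_self e])
    rw [sub_zero] at h
    have h3 : 2 * |e| * t ≤ 2 * |e| * T := mul_le_mul_of_nonneg_left ht.2.le (by positivity)
    linarith [le_abs_self w₀]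
  refine ⟨inertia m (z 0).1 + 2 * W * T, fun t ht => ?_⟩
  have h := le_add_mul_of_hasDerivWithinAt (C := 2 * W) le_rfl ht.1
    (fun s hs => hz.hasDerivWithinAt_inertia (m := m) (hsub t ht s hs))
    (fun s hs => by linarith [hw s ⟨hs.1, hs.2.trans ht.2⟩])
  rw [sub_zero] at h
  have hW0 : 0 ≤ W := by positivity
  have : 2 * W * t ≤ 2 * W * T := mul_le_mul_of_nonneg_left ht.2.le (by positivity)
  linarith

/-! ### Collision and global existence -/

/-- If `K_ω < 0` from some time on, the moment of inertia is uniformly concave, so that the lifespan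
is finite, and the solution experiences a collision. -/
theorem IsMaximalSolution.collisionSingularity_of_threshold_neg (hN : 2 ≤ N) (hm : ∀ i, 0 < m i)
    (hα : 2 < α) (hω : 0 < ω) (hz : IsMaximalSolution m α σ z) {t₁ : ℝ} (ht₁ : t₁ ∈ lifespan σ)
    (hK : z t₁ ∈ setK m α ω) (hneg : ∀ t ∈ lifespan σ, t₁ < t → threshold m α ω (z t).1 < 0) :
    CollisionSingularity σ z := by
  have hα0 : 0 < α := by linarith
  have hsol := hz.isSolution
  obtain ⟨t₀, ht₀, h10⟩ := exists_gt_mem_lifespan ht₁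
  set δ := 2 * (excitedEnergy m α ω - energy m α (z t₁).1 (z t₁).2) with hδdef
  have hδ : 0 < δ := by linarith [hK.2.1]
  have hD : ∀ t ∈ lifespan σ, t₀ ≤ t →
      2 * energy m α (z t).1 (z t).2 + (α - 2) * potential m α (z t).1 ≤ -δ := by
    intro t ht h
    refine (virial_deriv_le hN hm hα hω (hsol.noCollision t ht)
      (hneg t ht (h10.trans_le h)).le).trans ?_
    rw [hsol.energy_eq hm hα0 ht ht₁]
  have hfin : σ ≠ ⊤ := by
    rintro rfl
    have hall : ∀ t : ℝ, 0 ≤ t → t ∈ lifespan ⊤ := fun t ht => ⟨ht, EReal.coe_lt_top t⟩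
    have h0 := ht₀.1
    set w₀ := virial m (z t₀).1 (z t₀).2 with hw₀
    have hw : ∀ t, t₀ ≤ t → virial m (z t).1 (z t).2 ≤ w₀ + -δ * (t - t₀) := fun t ht =>
      le_add_mul_of_hasDerivWithinAt h0 ht
        (fun s hs => hsol.hasDerivWithinAt_virial hm hα0 (hall s (h0.trans hs.1)))
        (fun s hs => hD s (hall s (h0.trans hs.1)) hs.1)
    -- from the time `b` on, the moment of inertia decreases at least with speed `2`
    set b := t₀ + (|w₀| + 1) / δ with hb
    have hb0 : t₀ ≤ b := by
      have : 0 ≤ (|w₀| + 1) / δ := by positivity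
      linarith
    have hw1 : ∀ t, b ≤ t → virial m (z t).1 (z t).2 ≤ -1 := by
      intro t ht
      have h1 := hw t (hb0.trans ht)
      have h2 : |w₀| + 1 ≤ δ * (t - t₀) := by
        have h3 : (|w₀| + 1) / δ ≤ t - t₀ := by linarith
        rw [div_le_iff₀ hδ] at h3
        linarith
      linarith [le_abs_self w₀]
    have hI0 := inertia_nonneg hm (z b).1
    have hI := le_add_mul_of_hasDerivWithinAt (f := fun s => inertia m (z s).1) (C := -2)
      (h0.trans hb0) (by linarith : b ≤ b + (inertia m (z b).1 + 1))
      (fun s hs => hsol.hasDerivWithinAt_inertia (hall s ((h0.trans hb0).trans hs.1)))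
      (fun s hs => by linarith [hw1 s hs.1])
    have := inertia_nonneg hm (z (b + (inertia m (z b).1 + 1))).1
    linarith
  obtain ⟨T, rfl⟩ := exists_eq_coe_of_ne_top hsol.pos hfin
  obtain ⟨R, hR⟩ := hsol.exists_inertia_le hN hm hα
  have ht₀' := mem_lifespan_coe.1 ht₀
  have hsub : Ico t₀ T ⊆ lifespan (T : EReal) := fun t ht =>
    mem_lifespan_coe.2 ⟨ht₀'.1.trans ht.1, ht.2⟩
  refine hz.collisionSingularity hm hα0 ht₀' (fun t ht => hR t (mem_lifespan_coe.1 (hsub ht))) ?_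
  have hint : interior (Ico t₀ T) ⊆ Ico t₀ T := interior_subset
  refine concaveOn_of_hasDerivWithinAt2_nonpos (convex_Ico t₀ T)
    (f' := fun t => 2 * virial m (z t).1 (z t).2)
    (f'' := fun t => 2 * (2 * energy m α (z t).1 (z t).2 + (α - 2) * potential m α (z t).1))
    (fun t ht => (hsol.hasDerivWithinAt_inertia (hsub ht)).continuousWithinAt.mono
      fun s hs => (hsub hs).1)
    (fun t ht => (hsol.hasDerivWithinAt_inertia (hsub (hint ht))).mono
      fun s hs => (hsub (hint hs)).1)
    (fun t ht => ((hsol.hasDerivWithinAt_virial hm hα0 (hsub (hint ht))).const_mul 2).mono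
      fun s hs => (hsub (hint hs)).1)
    (fun t ht => ?_)
  have := hD t (hsub (hint ht)) (hint ht).1
  linarith

/-- A solution with finite lifespan `[0, T)` has `K_ω < 0` near `T`: otherwise the potential would
be bounded along a sequence of times, and there would be a collision-free limit point. -/
theorem IsMaximalSolution.not_frequently_threshold_nonneg (hN : 2 ≤ N) (hm : ∀ i, 0 < m i)
    (hα : 2 < α) {T : ℝ} (hz : IsMaximalSolution m α (T : EReal) z) :
    ¬ ∃ᶠ t in 𝓝[<] T, 0 ≤ threshold m α ω (z t).1 := by
  intro hfreq
  have hα0 : 0 < α := by linarith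
  have hsol := hz.isSolution
  have hT : 0 < T := by exact_mod_cast hsol.pos
  obtain ⟨R, hR⟩ := hsol.exists_inertia_le hN hm hα
  set C := ω ^ 2 * R / α with hC
  set S : Set (Config N) := Metric.closedBall 0 (∑ i, Real.sqrt (R / m i)) ∩
    {y | ∀ i j, i ≠ j → m i * m j ≤ C * ‖y i - y j‖ ^ α} with hS
  have hcl : IsClosed {y : Config N | ∀ i j, i ≠ j → m i * m j ≤ C * ‖y i - y j‖ ^ α} := by
    simp only [ofPred_forall]
    refine isClosed_iInter fun i => isClosed_iInter fun j => isClosed_iInter fun _ =>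
      isClosed_le continuous_const (continuous_const.mul ?_)
    exact (continuous_norm.comp ((continuous_apply i).sub (continuous_apply j))).rpow_const
      fun _ => Or.inr hα0.le
  have hev : ∀ᶠ t in 𝓝[<] T, t ∈ Ico 0 T := Ico_mem_nhdsLT hT
  have hmem : ∃ᶠ t in 𝓝[<] T, (z t).1 ∈ S := by
    refine (hfreq.and_eventually hev).mono fun t ⟨hK, ht⟩ => ⟨?_, fun i j hij => ?_⟩
    · simpa using norm_le_of_inertia_le hm (hR t ht)
    · have hd := dist_pos_of_notMem (hsol.noCollision t (mem_lifespan_coe.2 ht)) hij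
      rw [← div_le_iff₀ (Real.rpow_pos_of_pos hd α)]
      refine (pair_le_neg_potential hm hij).trans ?_
      rw [hC, le_div_iff₀ hα0]
      unfold threshold at hK
      have := mul_le_mul_of_nonneg_left (hR t ht) (sq_nonneg ω)
      linarith
  obtain ⟨p, hpS, hp⟩ :=
    ((isCompact_closedBall _ _).inter_right hcl).exists_mapClusterPt_of_frequently hmem
  obtain ⟨i, j, hij, h⟩ := hz.mem_collisionSet_of_mapClusterPt hm hα0 hp
  have h1 := hpS.2 i j hij
  rw [h, sub_self, norm_zero, Real.zero_rpow hα0.ne', mul_zero] at h1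
  exact absurd h1 (not_le.2 (mul_pos (hm i) (hm j)))

theorem IsMaximalSolution.eq_top_of_threshold_nonneg (hN : 2 ≤ N) (hm : ∀ i, 0 < m i)
    (hα : 2 < α) (hz : IsMaximalSolution m α σ z) {t₁ : ℝ} (ht₁ : t₁ ∈ lifespan σ)
    (h : ∀ t ∈ lifespan σ, t₁ < t → 0 ≤ threshold m α ω (z t).1) : σ = ⊤ := by
  by_contra hσ
  obtain ⟨T, rfl⟩ := exists_eq_coe_of_ne_top hz.isSolution.pos hσ
  have ht₁' := mem_lifespan_coe.1 ht₁
  refine hz.not_frequently_threshold_nonneg (ω := ω) hN hm hα (Eventually.frequently ?_)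
  filter_upwards [Ioo_mem_nhdsLT ht₁'.2] with t ht
  exact h t (mem_lifespan_coe.2 ⟨ht₁'.1.trans ht.1.le, ht.2⟩) ht.1

/-- Infinitely many sign changes of `K_ω` imply global existence. They cannot accumulate inside the
lifespan because `K_ω` is analytic in time. -/
theorem IsMaximalSolution.eq_top_of_alternating (hN : 2 ≤ N) (hm : ∀ i, 0 < m i)
    (hα : 2 < α) (hz : IsMaximalSolution m α σ z) {τ : ℕ → ℝ} (hτ : StrictMono τ)
    (hmem : ∀ n, τ n ∈ lifespan σ) (h0 : ∀ n, 0 ≤ threshold m α ω (z (τ (2 * n))).1)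
    (h1 : ∀ n, threshold m α ω (z (τ (2 * n + 1))).1 < 0) : σ = ⊤ := by
  by_contra hσ
  have hsol := hz.isSolution
  obtain ⟨T, rfl⟩ := exists_eq_coe_of_ne_top hsol.pos hσ
  simp only [mem_lifespan_coe] at hmem
  have hbdd : BddAbove (range τ) := ⟨T, by rintro _ ⟨n, rfl⟩; exact (hmem n).2.le⟩
  have hlim := tendsto_atTop_ciSup hτ.monotone hbdd
  set L := ⨆ n, τ n with hL
  have hlt : ∀ n, τ n < L := fun n =>
    (hτ (Nat.lt_succ_self n)).trans_le (le_ciSup hbdd (n + 1))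
  have hL0 : 0 < L := (hmem 0).1.trans_lt (hlt 0)
  have hLT : L ≤ T := ciSup_le fun n => (hmem n).2.le
  rcases hLT.eq_or_lt with h | h
  · refine hz.not_frequently_threshold_nonneg (ω := ω) hN hm hα ?_
    rw [← h]
    have ht : Tendsto (fun n => τ (2 * n)) atTop (𝓝[<] L) :=
      tendsto_nhdsWithin_iff.2 ⟨hlim.comp (tendsto_atTop_mono
        (fun n => by change n ≤ 2 * n; omega) tendsto_id), Eventually.of_forall fun n => hlt _⟩
    exact ht.frequently (Eventually.frequently (Eventually.of_forall h0))
  · have hev : ∀ᶠ t in 𝓝 L, t ∈ Ioo 0 T := Ioo_mem_nhds hL0 h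
    have hin : ∀ t ∈ Ioo 0 T, t ∈ lifespan (T : EReal) := fun t ht =>
      mem_lifespan_coe.2 ⟨ht.1.le, ht.2⟩
    have han : AnalyticAt ℝ (fun t => (z t).1) L :=
      analyticAt_of_eventually (α := α) (v := fun t => (z t).2) hm
        (hev.mono fun t ht => (hsol.velocity t (hin t ht)).hasDerivAt (Ici_mem_nhds ht.1))
        (hev.mono fun t ht => (hsol.acceleration t (hin t ht)).hasDerivAt (Ici_mem_nhds ht.1))
        (hev.mono fun t ht => hsol.noCollision t (hin t ht))
    exact not_alternating_of_analyticAt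
      ((analyticAt_threshold m α ω (hsol.noCollision L (hin L ⟨hL0, h⟩))).comp
        (f := fun t => (z t).1) han) hτ hlim h0 h1

/-! ### Crossing the level `ω I = |A|` -/

theorem IsSolution.continuousOn_inertia (hz : IsSolution m α σ z) {a b : ℝ}
    (ha : a ∈ lifespan σ) (hb : b ∈ lifespan σ) (ω : ℝ) :
    ContinuousOn (fun t => ω * inertia m (z t).1) (Icc a b) := fun _ ht =>
  ((hz.hasDerivWithinAt_inertia (Icc_subset_lifespan ha hb ht)).const_mul
    ω).continuousWithinAt.mono fun _ hs => ha.1.trans hs.1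

/-- Below the excited energy, once `ω I` has come down to `|A|`, it never exceeds `|A|` again: at
the first such time `I` is not increasing, and it is strictly concave where `ω I ≤ |A|`. -/
theorem IsSolution.inertia_le_of_crossing (hN : 2 ≤ N) (hm : ∀ i, 0 < m i)
    (hα : 2 < α) (hω : 0 < ω) (hz : IsSolution m α σ z) {s t₁ b : ℝ} (hs : s ∈ lifespan σ)
    (ht₁ : t₁ ∈ lifespan σ) (hst : s ≤ t₁) (hK : z s ∈ setK m α ω)
    (hs1 : ‖angularMomentum m (z s).1 (z s).2‖ < ω * inertia m (z s).1)
    (ht1 : ω * inertia m (z t₁).1 ≤ ‖angularMomentum m (z t₁).1 (z t₁).2‖) (hb : b ∈ lifespan σ)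
    (htb : t₁ ≤ b) : ω * inertia m (z b).1 ≤ ‖angularMomentum m (z b).1 (z b).2‖ := by
  have hα0 : 0 < α := by linarith
  set c := ‖angularMomentum m (z s).1 (z s).2‖ with hc
  have hA : ∀ t ∈ lifespan σ, ‖angularMomentum m (z t).1 (z t).2‖ = c := fun t ht => by
    rw [hc, hz.angularMomentum_eq hm ht hs]
  rw [hA _ ht₁] at ht1
  rw [hA _ hb]
  obtain ⟨r, hr, hrc, hbefore⟩ := exists_first_hit (ρ := -c)
    (g := fun t => -(ω * inertia m (z t).1)) hst (hz.continuousOn_inertia hs ht₁ ω).neg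
    (neg_lt_neg hs1) (neg_le_neg ht1)
  have hrL : r ∈ lifespan σ := Icc_subset_lifespan hs ht₁ ⟨hr.1.le, hr.2⟩
  have hvc : ∀ t ∈ lifespan σ,
      ContinuousWithinAt (fun t => virial m (z t).1 (z t).2) (Ici 0) t :=
    fun t ht => (hz.hasDerivWithinAt_virial hm hα0 ht).continuousWithinAt
  -- at the first crossing time the moment of inertia is not increasing
  have hwr : virial m (z r).1 (z r).2 ≤ 0 := by
    by_contra hpos
    have hev : ∀ᶠ t in 𝓝[Icc s r] r, 0 < virial m (z t).1 (z t).2 :=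
      ((hvc r hrL).mono fun t ht => hs.1.trans ht.1).eventually_const_lt (not_le.1 hpos)
    rw [nhdsWithin_Icc_eq_nhdsLE hr.1] at hev
    obtain ⟨l, hl, hlr⟩ := (mem_nhdsLE_iff_exists_Ioc_subset).1 hev
    obtain ⟨a, ha⟩ := exists_between (max_lt hl hr.1)
    have hsa : s < a := (le_max_right _ _).trans_lt ha.1
    have haL : a ∈ lifespan σ := Icc_subset_lifespan hs hrL ⟨hsa.le, ha.2.le⟩
    have h1 := le_add_mul_of_hasDerivWithinAt (f := fun t => -inertia m (z t).1) (C := 0)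
      (hs.1.trans hsa.le) ha.2.le
      (fun t ht => (hz.hasDerivWithinAt_inertia (Icc_subset_lifespan haL hrL ht)).fun_neg)
      (fun t ht => by
        have : 0 < virial m (z t).1 (z t).2 :=
          hlr ⟨(le_max_left _ _).trans_lt (ha.1.trans_le ht.1), ht.2.le⟩
        linarith)
    have h2 := hbefore a ⟨hsa.le, ha.2⟩
    have h3 : ω * inertia m (z a).1 ≤ ω * inertia m (z r).1 :=
      mul_le_mul_of_nonneg_left (by linarith) hω.le
    linarith
  -- continuous induction: the conditions `ω I ≤ c` and `I' ≤ 0` propagate together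
  set S : Set ℝ := {t | ω * inertia m (z t).1 ≤ c ∧ virial m (z t).1 (z t).2 ≤ 0} with hS
  suffices h : Icc r b ⊆ S from (h ⟨hr.2.trans htb, le_rfl⟩).1
  have hsub : Icc r b ⊆ lifespan σ := Icc_subset_lifespan hrL hb
  refine IsClosed.Icc_subset_of_forall_exists_gt ?_ ⟨by linarith, hwr⟩ ?_
  · have h1 : S ∩ Icc r b = (Icc r b ∩ (fun t => ω * inertia m (z t).1) ⁻¹' Iic c) ∩
        (Icc r b ∩ (fun t => virial m (z t).1 (z t).2) ⁻¹' Iic 0) := by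
      ext t
      simp only [hS, mem_inter_iff, mem_ofPred_eq, mem_preimage, mem_Iic]
      tauto
    rw [h1]
    refine IsClosed.inter ?_ ?_
    · exact (hz.continuousOn_inertia hrL hb ω).preimage_isClosed_of_isClosed isClosed_Icc
        isClosed_Iic
    · exact ContinuousOn.preimage_isClosed_of_isClosed
        (fun t ht => (hvc t (hsub ht)).mono fun u hu => (hsub hu).1) isClosed_Icc isClosed_Iic
  · rintro t ⟨⟨hti, htw⟩, htI⟩ y hy
    have htL := hsub ⟨htI.1, htI.2.le⟩
    have hneg : threshold m α ω (z t).1 < 0 :=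
      threshold_neg_of_inertia_le hN hm hα hω (hz.mem_setK hm hα0 hs htL hK)
        (by rw [hA t htL]; exact hti)
    have hev : ∀ᶠ u in 𝓝[≥] t, threshold m α ω (z u).1 < 0 :=
      ((hz.continuousWithinAt_threshold htL).mono
        fun u hu => htL.1.trans hu).eventually_lt_const hneg
    obtain ⟨l, hl, hlt⟩ := (mem_nhdsGE_iff_exists_Ico_subset).1 hev
    obtain ⟨u, hu⟩ := exists_between (lt_min (lt_min hl htI.2) hy)
    have hul : u < l := hu.2.trans_le ((min_le_left _ _).trans (min_le_left _ _))
    have hub : u < b := hu.2.trans_le ((min_le_left _ _).trans (min_le_right _ _))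
    have huy : u < y := hu.2.trans_le (min_le_right _ _)
    have hsub' : ∀ q ∈ Icc t u, q ∈ lifespan σ := fun q hq =>
      hsub ⟨htI.1.trans hq.1, hq.2.trans hub.le⟩
    have hw : ∀ q ∈ Icc t u, virial m (z q).1 (z q).2 ≤ 0 := by
      intro q hq
      have h1 := le_add_mul_of_hasDerivWithinAt (C := 0) htL.1 hq.1
        (fun v hv => hz.hasDerivWithinAt_virial hm hα0 (hsub' v ⟨hv.1, hv.2.trans hq.2⟩))
        (fun v hv => by
          have hvL := hsub' v ⟨hv.1, hv.2.le.trans hq.2⟩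
          have h2 := virial_deriv_le (p := z v) hN hm hα hω (hz.noCollision v hvL)
            (hlt ⟨hv.1, (hv.2.trans_le hq.2).trans hul⟩ : threshold m α ω (z v).1 < 0).le
          linarith [(hz.mem_setK hm hα0 hs hvL hK).2.1])
      linarith
    refine ⟨u, ⟨?_, hw u ⟨hu.1.le, le_rfl⟩⟩, hu.1, huy.le⟩
    have h1 := le_add_mul_of_hasDerivWithinAt (f := fun t => inertia m (z t).1) (C := 0)
      htL.1 hu.1.le (fun v hv => hz.hasDerivWithinAt_inertia (hsub' v hv))
      (fun v hv => by linarith [hw v ⟨hv.1, hv.2.le⟩])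
    have h3 : ω * inertia m (z u).1 ≤ ω * inertia m (z t).1 :=
      mul_le_mul_of_nonneg_left (by linarith) hω.le
    exact h3.trans hti

/-- Between a time with `|A| < ω I` and a later one with `|A| ≥ ω I` there is a time in `𝒦₂⁻`. -/
theorem IsSolution.exists_mem_setK2m_of_entering (hN : 2 ≤ N) (hm : ∀ i, 0 < m i)
    (hα : 2 < α) (hω : 0 < ω) (hz : IsSolution m α σ z) {s t : ℝ} (hs : s ∈ lifespan σ)
    (ht : t ∈ lifespan σ) (hst : s ≤ t) (hK : z s ∈ setK m α ω)
    (hs1 : ‖angularMomentum m (z s).1 (z s).2‖ < ω * inertia m (z s).1)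
    (ht1 : ω * inertia m (z t).1 ≤ ‖angularMomentum m (z t).1 (z t).2‖) :
    ∃ r ∈ lifespan σ, s < r ∧ r ≤ t ∧ z r ∈ setK2m m α ω := by
  have hα0 : 0 < α := by linarith
  have hA : ∀ r ∈ lifespan σ, angularMomentum m (z r).1 (z r).2 =
      angularMomentum m (z s).1 (z s).2 := fun r hr => hz.angularMomentum_eq hm hr hs
  rw [hA t ht] at ht1
  obtain ⟨q, hq, hqc, hbefore⟩ := exists_first_hit (g := fun t => -(ω * inertia m (z t).1))
    hst (hz.continuousOn_inertia hs ht ω).neg (neg_lt_neg hs1) (neg_le_neg ht1)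
  have hqL : q ∈ lifespan σ := Icc_subset_lifespan hs ht ⟨hq.1.le, hq.2⟩
  have hneg : threshold m α ω (z q).1 < 0 :=
    threshold_neg_of_inertia_le hN hm hα hω (hz.mem_setK hm hα0 hs hqL hK)
      (by rw [hA q hqL]; linarith)
  have hev : ∀ᶠ u in 𝓝[Ioo s q] q, threshold m α ω (z u).1 < 0 :=
    ((hz.continuousWithinAt_threshold hqL).mono
      fun u hu => hs.1.trans hu.1.le).eventually_lt_const hneg
  rw [nhdsWithin_Ioo_eq_nhdsLT hq.1] at hev
  obtain ⟨r, hr1, hr⟩ := (hev.and (Ioo_mem_nhdsLT hq.1)).exists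
  have hrL : r ∈ lifespan σ := Icc_subset_lifespan hs hqL ⟨hr.1.le, hr.2.le⟩
  refine ⟨r, hrL, hr.1, hr.2.le.trans hq.2, hz.mem_setK hm hα0 hs hrL hK, ?_, hr1⟩
  rw [hA r hrL]
  exact neg_lt_neg_iff.1 (hbefore r ⟨hr.1.le, hr.2⟩)

/-- Between a time with `|A| ≥ ω I` and a later one with `|A| < ω I` there is a time in `𝒦₂⁻`. -/
theorem IsSolution.exists_mem_setK2m_of_leaving (hN : 2 ≤ N) (hm : ∀ i, 0 < m i)
    (hα : 2 < α) (hω : 0 < ω) (hz : IsSolution m α σ z) {s t : ℝ} (hs : s ∈ lifespan σ)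
    (ht : t ∈ lifespan σ) (hst : s ≤ t) (hK : z s ∈ setK m α ω)
    (hs1 : ω * inertia m (z s).1 ≤ ‖angularMomentum m (z s).1 (z s).2‖)
    (ht1 : ‖angularMomentum m (z t).1 (z t).2‖ < ω * inertia m (z t).1) :
    ∃ r ∈ lifespan σ, s < r ∧ r ≤ t ∧ z r ∈ setK2m m α ω := by
  have hα0 : 0 < α := by linarith
  have hA : ∀ r ∈ lifespan σ, angularMomentum m (z r).1 (z r).2 =
      angularMomentum m (z s).1 (z s).2 := fun r hr => hz.angularMomentum_eq hm hr hs
  rw [hA t ht] at ht1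
  obtain ⟨q, hq, hqc, hafter⟩ := exists_last_hit hst (hz.continuousOn_inertia hs ht ω) hs1 ht1
  have hqL : q ∈ lifespan σ := Icc_subset_lifespan hs ht ⟨hq.1, hq.2.le⟩
  have hneg : threshold m α ω (z q).1 < 0 :=
    threshold_neg_of_inertia_le hN hm hα hω (hz.mem_setK hm hα0 hs hqL hK)
      (by rw [hA q hqL]; exact hqc.le)
  have hev : ∀ᶠ u in 𝓝[Ioo q t] q, threshold m α ω (z u).1 < 0 :=
    ((hz.continuousWithinAt_threshold hqL).mono
      fun u hu => hqL.1.trans hu.1.le).eventually_lt_const hneg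
  rw [nhdsWithin_Ioo_eq_nhdsGT hq.2] at hev
  obtain ⟨r, hr1, hr⟩ := (hev.and (Ioo_mem_nhdsGT hq.2)).exists
  have hrL : r ∈ lifespan σ := Icc_subset_lifespan hqL ht ⟨hr.1.le, hr.2.le⟩
  refine ⟨r, hrL, hq.1.trans_lt hr.1, hr.2.le, hz.mem_setK hm hα0 hs hrL hK, ?_, hr1⟩
  rw [hA r hrL]
  exact hafter r ⟨hr.1, hr.2.le⟩

end NBody

/-- Refinement of the characterization of the solutions below the excited energy. For a maximal
solution `z = (x, ẋ)` on `[0, σ)`, global existence is `σ = ⊤`. -/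
theorem theorem1p6 (N : ℕ) (hN : 3 ≤ N) (m : Fin N → ℝ) (hm : ∀ i, 0 < m i)
    (α : ℝ) (hα : 2 < α) (ω : ℝ) (hω : 0 < ω) :
    -- the set is the union of the four subsets
    NBody.setK m α ω = NBody.setK1p m α ω ∪ NBody.setK1m m α ω ∪
      NBody.setK2p m α ω ∪ NBody.setK2m m α ω ∧
    -- (a)
    NBody.setK1p m α ω = ∅ ∧
    ∀ (σ : EReal) (z : ℝ → NBody.Config N × NBody.Config N),
      NBody.IsMaximalSolution m α σ z →
      -- invariance
      (∀ s ∈ NBody.lifespan σ, ∀ t ∈ NBody.lifespan σ,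
        z s ∈ NBody.setK m α ω → z t ∈ NBody.setK m α ω) ∧
      -- (b), (c): `s = 0` means starting in the set, `s > 0` is the situation of (e)
      (∀ s ∈ NBody.lifespan σ, z s ∈ NBody.setK2m m α ω →
        -- (b)
        (∀ t₁ ∈ NBody.lifespan σ, s < t₁ → z t₁ ∈ NBody.setK1m m α ω →
          (∀ t ∈ NBody.lifespan σ, t₁ ≤ t → z t ∈ NBody.setK1m m α ω) ∧
          NBody.CollisionSingularity σ z) ∧
        -- (c)
        ((∀ t ∈ NBody.lifespan σ, s ≤ t → z t ∉ NBody.setK1m m α ω) →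
          (∀ t ∈ NBody.lifespan σ, s ≤ t →
            z t ∈ NBody.setK2p m α ω ∪ NBody.setK2m m α ω) ∧
          -- (c1)
          ((∃ t₁ ∈ NBody.lifespan σ, ∀ t ∈ NBody.lifespan σ, t₁ < t →
            z t ∈ NBody.setK2m m α ω) → NBody.CollisionSingularity σ z) ∧
          -- (c2)
          ((∃ t₁ ∈ NBody.lifespan σ, ∀ t ∈ NBody.lifespan σ, t₁ < t →
            z t ∈ NBody.setK2p m α ω) → σ = ⊤) ∧
          -- (c3)
          (NBody.InfinitelyManyTransitions σ z (NBody.setK2p m α ω) (NBody.setK2m m α ω) →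
            σ = ⊤))) ∧
      -- (d)
      ((∀ t ∈ NBody.lifespan σ, z t ∈ NBody.setK2p m α ω) → σ = ⊤) ∧
      ((∀ t ∈ NBody.lifespan σ, z t ∈ NBody.setK1m m α ω) → NBody.CollisionSingularity σ z) ∧
      -- (e): the sets can be left only through `𝒦₂⁻`, from where (b), (c) apply
      (∀ s ∈ NBody.lifespan σ, ∀ t ∈ NBody.lifespan σ, s < t →
        z s ∈ NBody.setK2p m α ω → z t ∉ NBody.setK2p m α ω →
        ∃ r ∈ NBody.lifespan σ, s < r ∧ r ≤ t ∧ z r ∈ NBody.setK2m m α ω) ∧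
      (∀ s ∈ NBody.lifespan σ, ∀ t ∈ NBody.lifespan σ, s < t →
        z s ∈ NBody.setK1m m α ω → z t ∉ NBody.setK1m m α ω →
        ∃ r ∈ NBody.lifespan σ, s < r ∧ r ≤ t ∧ z r ∈ NBody.setK2m m α ω) := by
  have hN2 : 2 ≤ N := by omega
  have hα0 : 0 < α := by linarith
  have hunion : ∀ p ∈ NBody.setK m α ω, p ∉ NBody.setK1m m α ω →
      p ∈ NBody.setK2p m α ω ∪ NBody.setK2m m α ω := by
    intro p hp hp1
    rcases le_or_gt (ω * NBody.inertia m p.1) ‖NBody.angularMomentum m p.1 p.2‖ with h | h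
    · exact absurd ⟨hp, h, NBody.threshold_neg_of_inertia_le hN2 hm hα hω hp h⟩ hp1
    · rcases le_or_gt 0 (NBody.threshold m α ω p.1) with h' | h'
      · exact Or.inl ⟨hp, h, h'⟩
      · exact Or.inr ⟨hp, h, h'⟩
  have ha : NBody.setK1p m α ω = ∅ := by
    refine Set.eq_empty_iff_forall_notMem.2 fun p hp => ?_
    exact absurd hp.2.2
      (not_le.2 (NBody.threshold_neg_of_inertia_le hN2 hm hα hω hp.1 hp.2.1))
  refine ⟨?_, ha, fun σ z hz => ?_⟩
  · ext p
    constructor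
    · intro hp
      by_cases hp1 : p ∈ NBody.setK1m m α ω
      · exact Or.inl (Or.inl (Or.inr hp1))
      · rcases hunion p hp hp1 with h | h
        · exact Or.inl (Or.inr h)
        · exact Or.inr h
    · rintro (((h | h) | h) | h) <;> exact h.1
  have hsol := hz.isSolution
  have hinv : ∀ s ∈ NBody.lifespan σ, ∀ t ∈ NBody.lifespan σ,
      z s ∈ NBody.setK m α ω → z t ∈ NBody.setK m α ω := fun s hs t ht h =>
    hsol.mem_setK hm hα0 hs ht h
  have h0 : (0 : ℝ) ∈ NBody.lifespan σ := NBody.zero_mem_lifespan hsol.pos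
  refine ⟨hinv, fun s hs hsK => ⟨fun t₁ ht₁ hst ht₁K => ?_, fun hnever => ⟨?_, ?_, ?_, ?_⟩⟩,
    ?_, ?_, ?_, ?_⟩
  · have hstay : ∀ t ∈ NBody.lifespan σ, t₁ ≤ t → z t ∈ NBody.setK1m m α ω := by
      intro t ht h
      have hle := hsol.inertia_le_of_crossing hN2 hm hα hω hs ht₁ hst.le hsK.1 hsK.2.1 ht₁K.2.1
        ht h
      have hK := hinv s hs t ht hsK.1
      exact ⟨hK, hle, NBody.threshold_neg_of_inertia_le hN2 hm hα hω hK hle⟩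
    exact ⟨hstay, hz.collisionSingularity_of_threshold_neg hN2 hm hα hω ht₁ ht₁K.1
      fun t ht h => (hstay t ht h.le).2.2⟩
  · exact fun t ht h => hunion _ (hinv s hs t ht hsK.1) (hnever t ht h)
  · rintro ⟨t₁, ht₁, h⟩
    exact hz.collisionSingularity_of_threshold_neg hN2 hm hα hω ht₁ (hinv s hs t₁ ht₁ hsK.1)
      fun t ht h' => (h t ht h').2.2
  · rintro ⟨t₁, ht₁, h⟩
    exact hz.eq_top_of_threshold_nonneg hN2 hm hα ht₁ fun t ht h' => (h t ht h').2.2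
  · rintro ⟨τ, hτ, hmem, halt⟩
    exact hz.eq_top_of_alternating hN2 hm hα hτ hmem (fun n => (halt n).1.2.2)
      fun n => (halt n).2.2.2
  · exact fun h => hz.eq_top_of_threshold_nonneg hN2 hm hα h0 fun t ht _ => (h t ht).2.2
  · exact fun h => hz.collisionSingularity_of_threshold_neg hN2 hm hα hω h0 (h 0 h0).1
      fun t ht _ => (h t ht).2.2
  · intro s hs t ht hst hsK htK
    have hK := hinv s hs t ht hsK.1
    by_cases h1 : z t ∈ NBody.setK1m m α ω
    · exact hsol.exists_mem_setK2m_of_entering hN2 hm hα hω hs ht hst.le hsK.1 hsK.2.1 h1.2.1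
    · exact ⟨t, ht, hst, le_rfl, (hunion _ hK h1).resolve_left htK⟩
  · intro s hs t ht hst hsK htK
    have hK := hinv s hs t ht hsK.1
    have hlt : ‖NBody.angularMomentum m (z t).1 (z t).2‖ < ω * NBody.inertia m (z t).1 := by
      rcases hunion _ hK htK with h | h <;> exact h.2.1
    exact hsol.exists_mem_setK2m_of_leaving hN2 hm hα hω hs ht hst.le hsK.1 hsK.2.1 hlt
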